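/- **Setting.** Let $T,m_1\ge 1$ and $m_2,n\ge 0$ be integers. For each fold $j=1,\dots,T$ let training data $(\hat x_i^{(j)},\hat y_i^{(j)})_{i\le m_2}$ and validation data $(\bar x_i^{(j)},\bar y_i^{(j)})_{i\le m_1}$ in $\mathbb R^n\times\{\pm1\}$ be given. Let $X\in\mathbb R^{Tn\times Tm_2}$ be the block diagonal matrix whose $j$-th block has columns $\hat x_i^{(j)}$, let $A\in\mathbb R^{Tm_1\times Tn}$ be the block diagonal matrix whose $j$-th block has rows $\bar y_i^{(j)}(\bar x_i^{(j)})^\top$, and let $\hat y\in\mathbb R^{Tm_2}$ be the stacked vector of the $\hat y_i^{(j)}$. For $w\in\mathbb R^{Tn}$, with functions of vectors taken entrywise and $t=X^\top w$, $a=Aw$, put $$g(w)=\tfrac12X\Big(\tfrac{1-e^{-t}}{1+e^{-t}}-\hat y\Big),\qquad \nabla g(w)=X\,\mathrm{Diag}(u(w))X^\top,\qquad \nabla f(w)=-A^\top\tfrac{1}{1+e^{a}},$$ $$u(w)=\tfrac1{2+e^{-t}+e^{t}},\qquad q(w)=\tfrac{e^{-t}(e^{-t}-1)}{(1+e^{-t})^3},\qquad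 p(w)=\tfrac{e^{a}}{(1+e^{a})^2}.$$ For $v=(C,w)\in\mathbb R\times\mathbb R^{Tn}$ and $\mu\in\mathbb R^{Tn}$ put $P(v)=I+C\nabla g(w)$, $$\alpha(\mu,v)=\tfrac1{Tm_1}A^\top\mathrm{Diag}(p(w))A+C\,X\,\mathrm{Diag}(X^\top\mu)\,\mathrm{Diag}(q(w))X^\top,$$ $$z(\mu,v)=g(w)^\top P(v)^{-1}\big(\alpha(\mu,v)P(v)^{-1}g(w)-2\nabla g(w)\mu\big)\qquad\text{(defined when $P(v)$ is invertible).}$$ Let $h(\varepsilon,t)$ be the Huber function: for $\varepsilon\ne0$ it equals $t-|\varepsilon|/2$ if $t>|\varepsilon|$, $t^2/(2|\varepsilon|)$ if $0\le t\le|\varepsilon|$, and $0$ if $t<0$; and $h(0,t)=\max\{0,t\}$. For $\kappa>0$ and $b=(\varepsilon,C,\mu,w)\in\mathbb R\times\mathbb R\times\mathbb R^{Tn}\times\mathbb R^{Tn}$ let $$\mathcal E(b)=\begin{pmatrix}(1+\kappa|\varepsilon|)C-h(\varepsilon,C-\mu^\top g(w))\\ \frac1{Tm_1}\nabla f(w)+(I+C\nabla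 g(w))\mu\\ w+Cg(w)\end{pmatrix},\qquad \hat{\mathcal E}(b)=\begin{pmatrix}\varepsilon\\ \mathcal E(b)\end{pmatrix},\qquad \psi(b)=\|\hat{\mathcal E}(b)\|^2,$$ with Euclidean norms throughout. **Algorithm SN.** Fix $\hat\varepsilon,\hat\eta,\hat r>0$, $r,\rho\in(0,1)$, $\sigma\in(0,\frac12)$, $\tau\in(0,1]$ with $\delta:=\sqrt2\max\{r\hat\varepsilon,\hat\eta\}<1$, and a starting point $b^0=(\varepsilon^0,C^0,\mu^0,w^0)$ with $\varepsilon^0>0$. At $b^k=(\varepsilon^k,C^k,\mu^k,w^k)$, stop if $\hat{\mathcal E}(b^k)=0$. Otherwise put $\eta_k=\min\{1,\hat r\|\hat{\mathcal E}(b^k)\|^\tau\}$ and $\zeta_k=r\min\{1,\|\hat{\mathcal E}(b^k)\|^{1+\tau}\}$; take any direction $\Delta b^k=(\Delta\varepsilon^k,\Delta C^k,\Delta\mu^k,\Delta w^k)$ with $\Delta\varepsilon^k=-\varepsilon^k+\zeta_k\hat\varepsilon$ whose residual $\mathcal R_k=\mathcal E(b^k)+\mathcal E'(b^k)\Delta b^k$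 satisfies $$\|\mathcal R_k\|\le\eta_k\big\|\mathcal E(b^k)+\partial_\varepsilon\mathcal E(b^k)\,\Delta\varepsilon^k\big\|\quad\text{and}\quad\|\mathcal R_k\|\le\hat\eta\,\|\hat{\mathcal E}(b^k)\|$$ (computed, for instance, by Bi-CG); let $\ell_k$ be the smallest integer $\ell\ge0$ with $\psi(b^k+\rho^\ell\Delta b^k)\le[1-2\sigma(1-\delta)\rho^\ell]\psi(b^k)$; and set $b^{k+1}=b^k+\rho^{\ell_k}\Delta b^k$. **Theorem.** Let $(b^k)_{k\ge0}$ be an infinite sequence generated by Algorithm SN, and let $b^*=(\varepsilon^*,C^*,\mu^*,w^*)$ be an accumulation point of it with $z(\mu^*,v^*)>0$, where $v^*=(C^*,w^*)$. Then $\hat{\mathcal E}(b^*)=0$, the whole sequence $(b^k)$ converges to $b^*$, and the convergence is superlinear: $$\|b^{k+1}-b^*\|=O\big(\|b^k-b^*\|^{1+\tau}\big),\qquad\text{in particular}\qquad \|b^{k+1}-b^*\|=o\big(\|b^k-b^*\|\big)\qquad(k\to\infty).$$ Moreover the unit step is eventually accepted: $\ell_k=0$, that is $b^{k+1}=b^k+\Delta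 b^k$, for all sufficiently large $k$. -/

import Mathlib

open Matrix Filter Topology Asymptotics

noncomputable section

namespace SquaredSmoothingNewton

/-- The data of `T`-fold cross validation in `ℝⁿ`: in fold `j` there are `m₂` labelled training
points `(x̂ᵢ⁽ʲ⁾, ŷᵢ⁽ʲ⁾)` and `m₁` labelled validation points `(x̄ᵢ⁽ʲ⁾, ȳᵢ⁽ʲ⁾)`, with labels `±1`. -/
structure CVData (T m₁ m₂ n : ℕ) where
  xhat : Fin T → Fin m₂ → Fin n → ℝ
  yhat : Fin T → Fin m₂ → ℝ
  xbar : Fin T → Fin m₁ → Fin n → ℝ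
  ybar : Fin T → Fin m₁ → ℝ
  yhat_label : ∀ j i, yhat j i = 1 ∨ yhat j i = -1
  ybar_label : ∀ j i, ybar j i = 1 ∨ ybar j i = -1

/-- The Huber smoothing function `h(ε, t)` of the plus function `t ↦ max {0, t}`. -/
def huber (ε t : ℝ) : ℝ :=
  if ε = 0 then max 0 t
  else if |ε| < t then t - |ε| / 2
  else if 0 ≤ t then t ^ 2 / (2 * |ε|)
  else 0

/-- The Euclidean space `ℝ^{Tn}`; the coordinate `(a, j)` is the `a`-th coordinate of the `j`-th
block. -/
abbrev Vec (T n : ℕ) : Type := EuclideanSpace ℝ (Fin n × Fin T)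

/-- `ℝ × ℝ^{Tn} × ℝ^{Tn}` with the Euclidean norm: triples `(C, μ, w)`. -/
abbrev Triple (T n : ℕ) : Type := WithLp 2 (ℝ × WithLp 2 (Vec T n × Vec T n))

/-- `ℝ × ℝ × ℝ^{Tn} × ℝ^{Tn}` with the Euclidean norm: quadruples `b = (ε, C, μ, w)`. -/
abbrev State (T n : ℕ) : Type := WithLp 2 (ℝ × Triple T n)

namespace State

variable {T n : ℕ}

/-- The component `ε` of `b = (ε, C, μ, w)`. -/
def eps (b : State T n) : ℝ := b.fst

/-- The component `C` of `b = (ε, C, μ, w)`. -/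
def C (b : State T n) : ℝ := b.snd.fst

/-- The component `μ` of `b = (ε, C, μ, w)`. -/
def mu (b : State T n) : Fin n × Fin T → ℝ := b.snd.snd.fst.ofLp

/-- The component `w` of `b = (ε, C, μ, w)`. -/
def w (b : State T n) : Fin n × Fin T → ℝ := b.snd.snd.snd.ofLp

end State

namespace CVData

variable {T m₁ m₂ n : ℕ} (D : CVData T m₁ m₂ n)

/-- The block diagonal matrix `X ∈ ℝ^{Tn × Tm₂}`, whose `j`-th block has the columns `x̂ᵢ⁽ʲ⁾`. -/
def X : Matrix (Fin n × Fin T) (Fin m₂ × Fin T) ℝ :=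
  Matrix.blockDiagonal fun j => Matrix.of fun a i => D.xhat j i a

/-- The block diagonal matrix `A ∈ ℝ^{Tm₁ × Tn}`, whose `j`-th block has the rows
`ȳᵢ⁽ʲ⁾ (x̄ᵢ⁽ʲ⁾)ᵀ`. -/
def A : Matrix (Fin m₁ × Fin T) (Fin n × Fin T) ℝ :=
  Matrix.blockDiagonal fun j => Matrix.of fun i a => D.ybar j i * D.xbar j i a

/-- The stacked vector `ŷ ∈ ℝ^{Tm₂}` of training labels. -/
def yhatVec : Fin m₂ × Fin T → ℝ := fun i => D.yhat i.2 i.1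

/-- `h_X(w)`; the `(i, j)` coordinate of `Xᵀ w` is `(x̂ᵢ⁽ʲ⁾)ᵀ w⁽ʲ⁾`. -/
def hX (w : Fin n × Fin T → ℝ) : Fin m₂ × Fin T → ℝ := fun i =>
  (1 - Real.exp (-(D.Xᵀ *ᵥ w) i)) / (1 + Real.exp (-(D.Xᵀ *ᵥ w) i))

/-- `g(w) = ½ X (h_X(w) - ŷ)`. -/
def g (w : Fin n × Fin T → ℝ) : Fin n × Fin T → ℝ :=
  (1 / 2 : ℝ) • (D.X *ᵥ (D.hX w - D.yhatVec))

/-- `s(w)`; the `(i, j)` coordinate of `A w` is `ȳᵢ⁽ʲ⁾ (x̄ᵢ⁽ʲ⁾)ᵀ w⁽ʲ⁾`. -/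
def s (w : Fin n × Fin T → ℝ) : Fin m₁ × Fin T → ℝ := fun i =>
  (1 + Real.exp ((D.A *ᵥ w) i))⁻¹

/-- `p(w)`, the negative of the derivative of the logistic terms `s(w)`. -/
def p (w : Fin n × Fin T → ℝ) : Fin m₁ × Fin T → ℝ := fun i =>
  Real.exp ((D.A *ᵥ w) i) / (1 + Real.exp ((D.A *ᵥ w) i)) ^ 2

/-- `u(w)`, half of the derivative of the terms `h_X(w)`. -/
def u (w : Fin n × Fin T → ℝ) : Fin m₂ × Fin T → ℝ := fun i =>
  (2 + Real.exp (-(D.Xᵀ *ᵥ w) i) + Real.exp ((D.Xᵀ *ᵥ w) i))⁻¹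

/-- `q(w)`, the derivative of the terms `u(w)`. -/
def q (w : Fin n × Fin T → ℝ) : Fin m₂ × Fin T → ℝ := fun i =>
  Real.exp (-(D.Xᵀ *ᵥ w) i) * (Real.exp (-(D.Xᵀ *ᵥ w) i) - 1) /
    (1 + Real.exp (-(D.Xᵀ *ᵥ w) i)) ^ 3

/-- `∇f(w) = -Aᵀ s(w)`, the gradient of `f(w) = ∑ log (1 + exp (-(A w)ᵢ))`. -/
def gradF (w : Fin n × Fin T → ℝ) : Fin n × Fin T → ℝ := -(D.Aᵀ *ᵥ D.s w)

/-- `∇g(w) = X Diag(u(w)) Xᵀ`, the (symmetric) Jacobian matrix of `g`. -/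
def gradG (w : Fin n × Fin T → ℝ) : Matrix (Fin n × Fin T) (Fin n × Fin T) ℝ :=
  D.X * Matrix.diagonal (D.u w) * D.Xᵀ

/-- `P(v) = I + C X Diag(u(w)) Xᵀ` for `v = (C, w)`. -/
def P (C : ℝ) (w : Fin n × Fin T → ℝ) : Matrix (Fin n × Fin T) (Fin n × Fin T) ℝ :=
  1 + C • D.gradG w

/-- `α(μ, v) = (1 / (T m₁)) Aᵀ Diag(p(w)) A + C X Diag(Xᵀ μ) Diag(q(w)) Xᵀ`. -/
def alpha (mu : Fin n × Fin T → ℝ) (C : ℝ) (w : Fin n × Fin T → ℝ) :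
    Matrix (Fin n × Fin T) (Fin n × Fin T) ℝ :=
  (1 / ((T : ℝ) * m₁)) • (D.Aᵀ * Matrix.diagonal (D.p w) * D.A) +
    C • (D.X * Matrix.diagonal (D.Xᵀ *ᵥ mu) * Matrix.diagonal (D.q w) * D.Xᵀ)

/-- `z(μ, v) = g(w)ᵀ P(v)⁻¹ (α(μ, v) P(v)⁻¹ g(w) - 2 ∇g(w) μ)`. If `P(v)` is singular, then the
matrix inverse is `0` by convention, so `0 < z(μ, v)` entails that `P(v)` is invertible. -/
def z (mu : Fin n × Fin T → ℝ) (C : ℝ) (w : Fin n × Fin T → ℝ) : ℝ :=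
  D.g w ⬝ᵥ ((D.P C w)⁻¹ *ᵥ
    (D.alpha mu C w *ᵥ ((D.P C w)⁻¹ *ᵥ D.g w) - (2 : ℝ) • (D.gradG w *ᵥ mu)))

/-- The smoothed reduced KKT map `𝓔(ε, C, μ, w)`. -/
def E (κ : ℝ) (b : State T n) : Triple T n :=
  WithLp.toLp 2
    ((1 + κ * |b.eps|) * b.C - huber b.eps (b.C - b.mu ⬝ᵥ D.g b.w),
      WithLp.toLp 2
        (WithLp.toLp 2 ((1 / ((T : ℝ) * m₁)) • D.gradF b.w + (1 + b.C • D.gradG b.w) *ᵥ b.mu),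
          WithLp.toLp 2 (b.w + b.C • D.g b.w)))

/-- The smoothing system `𝓔̂(ε, C, μ, w) = (ε, 𝓔(ε, C, μ, w))`. -/
def Ehat (κ : ℝ) (b : State T n) : State T n := WithLp.toLp 2 (b.eps, D.E κ b)

/-- The merit function `ψ = ‖𝓔̂‖²`. -/
def psi (κ : ℝ) (b : State T n) : ℝ := ‖D.Ehat κ b‖ ^ 2

end CVData

/-- The parameters of the algorithm, with the smoothing constant `κ`. -/
structure Params where
  κ : ℝ
  epsHat : ℝ
  r : ℝ
  etaHat : ℝ
  rHat : ℝ
  ρ : ℝ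
  σ : ℝ
  τ : ℝ
  κ_pos : 0 < κ
  epsHat_pos : 0 < epsHat
  r_mem : r ∈ Set.Ioo (0 : ℝ) 1
  etaHat_pos : 0 < etaHat
  delta_lt_one : √2 * max (r * epsHat) etaHat < 1
  rHat_pos : 0 < rHat
  ρ_mem : ρ ∈ Set.Ioo (0 : ℝ) 1
  σ_mem : σ ∈ Set.Ioo (0 : ℝ) (1 / 2)
  τ_mem : τ ∈ Set.Ioc (0 : ℝ) 1

namespace Params

/-- `δ = √2 max {r ε̂, η̂}`. -/
def delta (Q : Params) : ℝ := √2 * max (Q.r * Q.epsHat) Q.etaHat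

variable {T m₁ m₂ n : ℕ}

/-- `η(b) = min {1, r̂ ‖𝓔̂(b)‖^τ}`. -/
def eta (Q : Params) (D : CVData T m₁ m₂ n) (b : State T n) : ℝ :=
  min 1 (Q.rHat * ‖D.Ehat Q.κ b‖ ^ Q.τ)

/-- `ζ(b) = r min {1, ‖𝓔̂(b)‖^(1 + τ)}`. -/
def zeta (Q : Params) (D : CVData T m₁ m₂ n) (b : State T n) : ℝ :=
  Q.r * min 1 (‖D.Ehat Q.κ b‖ ^ (1 + Q.τ))

end Params

section Algorithm

variable {T m₁ m₂ n : ℕ}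

/-- The residual `𝓡 = 𝓔(b) + 𝓔'(b) d` of the linear system at `b` for the direction `d`. -/
def residual (D : CVData T m₁ m₂ n) (κ : ℝ) (b d : State T n) : Triple T n :=
  D.E κ b + fderiv ℝ (D.E κ) b d

/-- The partial derivative of `𝓔` in the variable `ε`. -/
def partialEps (D : CVData T m₁ m₂ n) (κ : ℝ) (b : State T n) : Triple T n :=
  fderiv ℝ (D.E κ) b (WithLp.toLp 2 (1, 0))

/-- `b` is an infinite sequence of iterates of the squared smoothing Newton method, `d` the
sequence of (inexact) search directions and `ℓ` that of the line search exponents. The directions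
are arbitrary approximate solutions of the Newton system that meet the required accuracy. -/
structure IsRun (D : CVData T m₁ m₂ n) (Q : Params) (b d : ℕ → State T n) (ℓ : ℕ → ℕ) :
    Prop where
  eps_zero_pos : 0 < (b 0).eps
  not_solved : ∀ k, D.Ehat Q.κ (b k) ≠ 0
  eps_step : ∀ k, (d k).eps = -(b k).eps + Q.zeta D (b k) * Q.epsHat
  residual_le_eta : ∀ k, ‖residual D Q.κ (b k) (d k)‖ ≤
    Q.eta D (b k) * ‖D.E Q.κ (b k) + (d k).eps • partialEps D Q.κ (b k)‖
  residual_le_etaHat : ∀ k, ‖residual D Q.κ (b k) (d k)‖ ≤ Q.etaHat * ‖D.Ehat Q.κ (b k)‖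
  line_search : ∀ k, IsLeast
    {l : ℕ | D.psi Q.κ (b k + Q.ρ ^ l • d k) ≤
      (1 - 2 * Q.σ * (1 - Q.delta) * Q.ρ ^ l) * D.psi Q.κ (b k)} (ℓ k)
  update : ∀ k, b (k + 1) = b k + Q.ρ ^ ℓ k • d k

end Algorithm

end SquaredSmoothingNewton

end

/-!
The only nonsmooth term of the system is the Huber function, and for `ε > 0` it is a maximum of
linear functions, `h(ε, t) = max {s t - s² ε / 2 | s ∈ [0, 1]}`, attained at the projection `s` of
`t / ε` onto `[0, 1]`. Hence it is continuously differentiable on `ε > 0` with gradient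
`(-s² / 2, s)` (`hasFDerivAt_huber`), and its linearizations at points near `(0, t₀)` are exact at
`(0, t₀)` (`eventually_huber_sub_eq`). So on the half space `ε > 0`, in which all iterates remain,
`𝓔̂` is continuously differentiable, and it is strongly semismooth at the points with `ε = 0`
(`exists_norm_sub_huberDeriv_le`).

The derivative of `𝓔̂` is a continuous function of the point and of the slope `s`, once `s` is treated
as an independent parameter (`huberDeriv`). Block elimination in the Newton system at `b*` leaves
the coefficient `1 - s + κ ε + s z(μ, v)` for the unknown `C`, so the condition `z > 0` makes the
derivative injective at `b*` for every `s ∈ [0, 1]` (`eq_zero_of_huberDeriv_eq_zero`); compactness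
of `[0, 1]` then gives a uniform bound on the inverses near `b*` (`exists_norm_le_of_injective`).

Suppose `𝓔̂(b*) ≠ 0`. Then `ζ_k` stays away from zero, hence so does `εᵏ`, and `𝓔̂` is smooth at `b*`.
Near `b*` the Newton directions are bounded and the residual is at most `δ ‖𝓔̂‖`, so a fixed step
length is always accepted and `‖𝓔̂‖²` drops by a fixed fraction infinitely often, which is impossible
(`eq_zero_of_mapClusterPt`). Therefore `𝓔̂(b*) = 0`. Near `b*` a full inexact Newton step then has
order `1 + τ`, by strong semismoothness and because the residual is `O(‖𝓔̂‖^(1 + τ))`; as `‖𝓔̂(b)‖`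
and `‖b - b*‖` are comparable, the step passes the line search (`exists_forall_newton_step`). One
iterate close to `b*` thus captures all later ones (`tendsto_and_isBigO_of_local_contraction`).
-/

noncomputable section

namespace SquaredSmoothingNewton

/-! ### The Huber function -/

/-- The slope `∂ₜ h(ε, t)` of the Huber function for `ε > 0`: the projection of `t / ε` onto
`[0, 1]`. -/
def huberSlope (ε t : ℝ) : ℝ := max 0 (min 1 (t / ε))

theorem huberSlope_mem (ε t : ℝ) : huberSlope ε t ∈ Set.Icc (0 : ℝ) 1 :=
  ⟨le_max_left _ _, max_le zero_le_one (min_le_left _ _)⟩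

theorem huber_eq {ε : ℝ} (hε : 0 < ε) (t : ℝ) :
    huber ε t = huberSlope ε t * t - huberSlope ε t ^ 2 / 2 * ε := by
  unfold huber huberSlope
  rw [if_neg hε.ne', abs_of_pos hε]
  split_ifs with h1 h2
  · rw [min_eq_left ((one_le_div hε).2 h1.le)]
    norm_num
    ring
  · rw [min_eq_right ((div_le_one hε).2 (not_lt.1 h1)), max_eq_right (by positivity)]
    field_simp
    ring
  · rw [max_eq_left]
    · ring
    · exact (min_le_right _ _).trans (div_nonpos_of_nonpos_of_nonneg (not_le.1 h2).le hε.le)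

/-- The Huber function is the maximum over `s ∈ [0, 1]` of the linear functions
`(ε, t) ↦ s t - s² ε / 2`. -/
theorem le_huber {ε : ℝ} (hε : 0 < ε) (t : ℝ) {s : ℝ} (hs : s ∈ Set.Icc (0 : ℝ) 1) :
    s * t - s ^ 2 / 2 * ε ≤ huber ε t := by
  unfold huber
  rw [if_neg hε.ne', abs_of_pos hε]
  obtain ⟨h0, h1⟩ := hs
  split_ifs with h2 h3
  · nlinarith [mul_nonneg (sub_nonneg.2 h1) (sub_nonneg.2 h2.le),
      mul_nonneg (sq_nonneg (1 - s)) hε.le]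
  · rw [le_div_iff₀ (by positivity)]
    nlinarith [sq_nonneg (t - s * ε)]
  · nlinarith [mul_nonneg h0 (neg_nonneg.2 (not_le.1 h3).le), mul_nonneg (sq_nonneg s) hε.le]

theorem continuousAt_huberSlope {x : ℝ × ℝ} (hx : 0 < x.1) :
    ContinuousAt (fun y : ℝ × ℝ => huberSlope y.1 y.2) x := by
  unfold huberSlope
  have : ContinuousAt (fun y : ℝ × ℝ => y.2 / y.1) x :=
    continuousAt_snd.div continuousAt_fst hx.ne'
  exact continuousAt_const.max (continuousAt_const.min this)

/-- The gradient `(-s² / 2, s)` of the linear function `(ε, t) ↦ s t - s² ε / 2`. -/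
def huberGrad (s : ℝ) : ℝ × ℝ →L[ℝ] ℝ :=
  s • ContinuousLinearMap.snd ℝ ℝ ℝ - (s ^ 2 / 2) • ContinuousLinearMap.fst ℝ ℝ ℝ

theorem huberGrad_apply (s : ℝ) (y : ℝ × ℝ) : huberGrad s y = s * y.2 - s ^ 2 / 2 * y.1 := by
  simp [huberGrad]

theorem continuous_huberGrad : Continuous huberGrad := by
  unfold huberGrad
  fun_prop

/-- As a maximum of linear functions, the Huber function is differentiable wherever the maximizer
is continuous: the increment is squeezed between the values of the maximizing linear functions at
the two end points. -/
theorem hasFDerivAt_huber {x : ℝ × ℝ} (hx : 0 < x.1) :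
    HasFDerivAt (fun y : ℝ × ℝ => huber y.1 y.2) (huberGrad (huberSlope x.1 x.2)) x := by
  rw [hasFDerivAt_iff_isLittleO, isLittleO_iff]
  intro c hc
  have hcont : ContinuousAt (fun y : ℝ × ℝ => huberGrad (huberSlope y.1 y.2)) x :=
    ContinuousAt.comp (g := huberGrad) continuous_huberGrad.continuousAt
      (continuousAt_huberSlope hx)
  filter_upwards [Metric.continuousAt_iff'.1 hcont c hc,
    continuousAt_fst.eventually (lt_mem_nhds hx)] with y hy hy1
  have lower := le_huber hy1 y.2 (huberSlope_mem x.1 x.2)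
  have upper := le_huber hx x.2 (huberSlope_mem y.1 y.2)
  have hgap := (huberGrad (huberSlope y.1 y.2) - huberGrad (huberSlope x.1 x.2)).le_opNorm (y - x)
  rw [dist_eq_norm] at hy
  have hle := hgap.trans (mul_le_mul_of_nonneg_right hy.le (norm_nonneg _))
  simp only [_root_.sub_apply, huberGrad_apply, Prod.snd_sub, Prod.fst_sub,
    Real.norm_eq_abs] at hle ⊢
  rw [abs_le] at hle ⊢
  have ex := huber_eq hx x.2
  have ey := huber_eq hy1 y.2
  constructor
  · have : 0 ≤ c * ‖y - x‖ := by positivity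
    linarith
  · linarith

/-- The Huber function is piecewise smooth with *linear* pieces near each point `(0, t₀)` with
`t₀ ≠ 0`, and positively homogeneous: its linearization at `(ε, t)` is exact at `(0, t₀)`. -/
theorem eventually_huber_sub_eq (t₀ : ℝ) :
    ∀ᶠ y in 𝓝 ((0 : ℝ), t₀), 0 < y.1 →
      huber y.1 y.2 - huber 0 t₀ =
        huberSlope y.1 y.2 * (y.2 - t₀) - huberSlope y.1 y.2 ^ 2 / 2 * y.1 := by
  have key : ∀ᶠ y in 𝓝 ((0 : ℝ), t₀), 0 < y.1 → huberSlope y.1 y.2 * t₀ = max 0 t₀ := by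
    rcases lt_trichotomy t₀ 0 with h | rfl | h
    · have : ∀ᶠ y in 𝓝 ((0 : ℝ), t₀), y.2 < 0 := continuousAt_snd.eventually (gt_mem_nhds h)
      filter_upwards [this] with y hy hy1
      have : huberSlope y.1 y.2 = 0 :=
        max_eq_left ((min_le_right _ _).trans (div_nonpos_of_nonpos_of_nonneg hy.le hy1.le))
      rw [this, max_eq_left h.le, zero_mul]
    · simp
    · have : ∀ᶠ y in 𝓝 ((0 : ℝ), t₀), y.1 < y.2 :=
        continuousAt_fst.eventually_lt continuousAt_snd h
      filter_upwards [this] with y hy hy1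
      have : huberSlope y.1 y.2 = 1 := by
        unfold huberSlope
        rw [min_eq_left ((one_le_div hy1).2 hy.le), max_eq_right zero_le_one]
      rw [this, max_eq_right h.le, one_mul]
  filter_upwards [key] with y hy hy1
  rw [huber_eq hy1, show huber 0 t₀ = max 0 t₀ by simp [huber], ← hy hy1]
  ring

/-! ### Second-order expansion and uniform invertibility -/

section Calculus

variable {V W : Type*} [NormedAddCommGroup V] [NormedSpace ℝ V]
  [NormedAddCommGroup W] [NormedSpace ℝ W]

/-- Second-order Taylor bound with the derivative taken at the moving point. -/
theorem exists_norm_sub_fderiv_le {f : V → W} (hf : ContDiff ℝ 2 f) (x₀ : V) :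
    ∃ K : ℝ, 0 ≤ K ∧ ∀ᶠ x in 𝓝 x₀,
      ‖f x - f x₀ - fderiv ℝ f x (x - x₀)‖ ≤ K * ‖x - x₀‖ ^ 2 := by
  have hf' : ContDiff ℝ 1 (fderiv ℝ f) := hf.fderiv_right (by norm_num)
  obtain ⟨K, s, hs, hK⟩ := (hf'.contDiffAt (x := x₀)).exists_lipschitzOnWith
  obtain ⟨r, hr, hrs⟩ := Metric.mem_nhds_iff.1 hs
  refine ⟨K, K.2, ?_⟩
  filter_upwards [Metric.ball_mem_nhds x₀ hr] with x hx
  have hdiff : Differentiable ℝ f := hf.differentiable (by norm_num)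
  have hseg : segment ℝ x₀ x ⊆ Metric.ball x₀ r :=
    (convex_ball x₀ r).segment_subset (Metric.mem_ball_self hr) hx
  have := (convex_segment x₀ x).norm_image_sub_le_of_norm_fderiv_le' (𝕜 := ℝ) (f := f)
    (φ := fderiv ℝ f x) (C := K * ‖x - x₀‖) (x := x₀) (y := x)
    (fun y _ => hdiff y) (fun y hy => ?_) (left_mem_segment ℝ x₀ x) (right_mem_segment ℝ x₀ x)
  · calc _ ≤ _ := this
      _ = _ := by ring
  · rw [← dist_eq_norm]
    refine (hK.dist_le_mul y (hrs (hseg hy)) x (hrs hx)).trans ?_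
    refine mul_le_mul_of_nonneg_left ?_ K.2
    obtain ⟨a, c, ha, hc, hac, rfl⟩ := hy
    rw [dist_eq_norm,
      show a • x₀ + c • x - x = (a • x₀ + c • x) - (a + c) • x by rw [hac, one_smul],
      show (a • x₀ + c • x) - (a + c) • x = -(a • (x - x₀)) by module, norm_neg, norm_smul,
      Real.norm_of_nonneg ha]
    exact mul_le_of_le_one_left (norm_nonneg _) (by linarith)

/-- A family of operators that depends continuously on a point and on a parameter in a compact
set, and is injective at `x₀` for all parameters, is uniformly bounded below near `x₀`. -/
theorem exists_norm_le_of_injective [FiniteDimensional ℝ V] {X S : Type*} [TopologicalSpace X]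
    [TopologicalSpace S] {J : X → S → V →L[ℝ] W}
    (hJ : Continuous fun q : X × S => J q.1 q.2) {K : Set S} (hK : IsCompact K) (x₀ : X)
    (hinj : ∀ s ∈ K, ∀ y, J x₀ s y = 0 → y = 0) :
    ∃ M : ℝ, 0 < M ∧ ∀ᶠ x in 𝓝 x₀, ∀ s ∈ K, ∀ y, ‖y‖ ≤ M * ‖J x s y‖ := by
  have hcomp : IsCompact (K ×ˢ Metric.sphere (0 : V) 1) := hK.prod (isCompact_sphere 0 1)
  have hcont : Continuous fun q : X × (S × V) => ‖J q.1 q.2.1 q.2.2‖ :=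
    ((hJ.comp (continuous_fst.prodMk continuous_snd.fst)).clm_apply continuous_snd.snd).norm
  have hpos : ∀ q ∈ K ×ˢ Metric.sphere (0 : V) 1, 0 < ‖J x₀ q.1 q.2‖ := by
    rintro ⟨s, y⟩ ⟨hs, hy⟩
    refine norm_pos_iff.2 fun h => ?_
    rw [hinj s hs y h] at hy
    simp at hy
  obtain ⟨c, hc, hcle⟩ : ∃ c : ℝ, 0 < c ∧
      ∀ q ∈ K ×ˢ Metric.sphere (0 : V) 1, c < ‖J x₀ q.1 q.2‖ := by
    rcases (K ×ˢ Metric.sphere (0 : V) 1).eq_empty_or_nonempty with h | h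
    · exact ⟨1, one_pos, by simp [h]⟩
    · obtain ⟨q, hq, hmin⟩ := hcomp.exists_isMinOn h
        (f := fun q : S × V => ‖J x₀ q.1 q.2‖)
        (hcont.comp (continuous_const.prodMk continuous_id)).continuousOn
      refine ⟨‖J x₀ q.1 q.2‖ / 2, half_pos (hpos q hq), fun p hp => ?_⟩
      exact (half_lt_self (hpos q hq)).trans_le (hmin hp)
  obtain ⟨U, U', hU, -, hxU, hKU', hsub⟩ := generalized_tube_lemma (isCompact_singleton (x := x₀))
    hcomp (isOpen_lt continuous_const hcont (f := fun _ => c))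
    (by rintro ⟨x, q⟩ ⟨rfl, hq⟩; exact hcle q hq)
  refine ⟨c⁻¹, inv_pos.2 hc, ?_⟩
  filter_upwards [hU.mem_nhds (hxU rfl)] with x hx s hs y
  rcases eq_or_ne y 0 with rfl | hy
  · simp
  have hy' : 0 < ‖y‖ := norm_pos_iff.2 hy
  have hmem : ((s, ‖y‖⁻¹ • y) : S × V) ∈ K ×ˢ Metric.sphere (0 : V) 1 :=
    ⟨hs, by simp [norm_smul, hy'.ne']⟩
  have : c < ‖J x s (‖y‖⁻¹ • y)‖ := hsub (Set.mk_mem_prod hx (hKU' hmem))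
  rw [map_smul, norm_smul, norm_inv, norm_norm, inv_mul_eq_div, lt_div_iff₀ hy'] at this
  rw [inv_mul_eq_div, le_div_iff₀ hc]
  linarith

end Calculus

/-! ### Line search and local convergence of inexact Newton steps -/

section Newton

variable {V : Type*} [NormedAddCommGroup V] [NormedSpace ℝ V]

/-- Near a point at which `H` is strictly differentiable with nonzero value, and where the
derivatives are uniformly invertible, all inexact Newton steps are accepted by the line search as
soon as the step length is below a uniform threshold. -/
theorem exists_forall_step_accepted {H : V → V} {DH : V → V →L[ℝ] V} {x₀ : V}
    (hH : HasStrictFDerivAt H (DH x₀) x₀) (hDH : ContinuousAt DH x₀) (hx₀ : H x₀ ≠ 0)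
    {M : ℝ} (hM : 0 < M) (hinv : ∀ᶠ x in 𝓝 x₀, ∀ y, ‖y‖ ≤ M * ‖DH x y‖)
    {δ σ : ℝ} (hδ₀ : 0 ≤ δ) (hδ : δ < 1) (hσ₀ : 0 < σ) (hσ : σ < 1 / 2) :
    ∃ t₀ : ℝ, 0 < t₀ ∧ ∀ᶠ x in 𝓝 x₀, ∀ d, ‖H x + DH x d‖ ≤ δ * ‖H x‖ →
      ∀ t, 0 < t → t ≤ t₀ → ‖H (x + t • d)‖ ^ 2 ≤ (1 - 2 * σ * (1 - δ) * t) * ‖H x‖ ^ 2 := by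
  set N := ‖H x₀‖ with hN
  have hNpos : 0 < N := norm_pos_iff.2 hx₀
  -- `B` bounds the length of the inexact Newton directions near `x₀`.
  set B := M * (2 * (2 * N)) with hB
  have hBpos : 0 < B := by positivity
  -- With `c` as the accuracy of the linearization, its error uses up only the fraction `1/2 - σ` of
  -- the decrease `(1 - δ) t ‖H x‖` that the inexact Newton direction promises.
  set c := (1 - δ) * (1 / 2 - σ) * (N / 2) / (2 * B) with hc
  have hcpos : 0 < c := by
    have h1 : 0 < 1 - δ := by linarith
    have h2 : 0 < 1 / 2 - σ := by linarith
    positivity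
  have hcB : 2 * c * B = (1 - δ) * (1 / 2 - σ) * (N / 2) := by
    rw [hc]; field_simp
  have hlin := isLittleO_iff.1 hH.isLittleO hcpos
  obtain ⟨r, hr, hrlin⟩ := Metric.eventually_nhds_iff.1 hlin
  refine ⟨min 1 (r / 2 / B), by positivity, ?_⟩
  filter_upwards [hinv, Metric.continuousAt_iff'.1 hDH c hcpos,
    Metric.ball_mem_nhds x₀ (half_pos hr),
    hH.continuousAt.norm.eventually (lt_mem_nhds (half_lt_self hNpos)),
    hH.continuousAt.norm.eventually (gt_mem_nhds (by linarith : N < 2 * N))]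
    with x hxinv hxD hxr hxlow hxup d hd t ht ht₀
  have hdB : ‖d‖ ≤ B := by
    have h1 : ‖DH x d‖ ≤ ‖H x + DH x d‖ + ‖H x‖ := by
      simpa using norm_sub_le (H x + DH x d) (H x)
    have h2 : ‖DH x d‖ ≤ 2 * (2 * N) := by nlinarith [norm_nonneg (H x)]
    exact (hxinv d).trans (mul_le_mul_of_nonneg_left h2 hM.le)
  have ht1 : t ≤ 1 := ht₀.trans (min_le_left _ _)
  have htB : t * B ≤ r / 2 := (le_div_iff₀ hBpos).1 (ht₀.trans (min_le_right _ _))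
  have htd : ‖t • d‖ = t * ‖d‖ := by rw [norm_smul, Real.norm_of_nonneg ht.le]
  have htd' : t * ‖d‖ ≤ t * B := mul_le_mul_of_nonneg_left hdB ht.le
  rw [Metric.mem_ball] at hxr
  have hstep := @hrlin (x + t • d, x) (by
    rw [Prod.dist_eq, max_lt_iff]
    refine ⟨?_, by change dist x x₀ < r; linarith⟩
    calc dist (x + t • d) x₀ ≤ dist (x + t • d) x + dist x x₀ := dist_triangle _ _ _
      _ < r / 2 + r / 2 := by
        refine add_lt_add_of_le_of_lt ?_ hxr
        rw [dist_eq_norm, add_sub_cancel_left, htd]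
        linarith
      _ = r := by ring)
  simp only [add_sub_cancel_left, htd] at hstep
  rw [dist_eq_norm] at hxD
  have hD := ((DH x - DH x₀).le_opNorm (t • d)).trans
    (mul_le_mul_of_nonneg_right hxD.le (norm_nonneg _))
  rw [htd, _root_.sub_apply] at hD
  have hres : ‖t • (H x + DH x d)‖ ≤ t * (δ * ‖H x‖) := by
    rw [norm_smul, Real.norm_of_nonneg ht.le]
    exact mul_le_mul_of_nonneg_left hd ht.le
  have h1t : ‖(1 - t) • H x‖ = (1 - t) * ‖H x‖ := by
    rw [norm_smul, Real.norm_of_nonneg (by linarith)]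
  have hsplit : H (x + t • d) = (1 - t) • H x + t • (H x + DH x d)
      + (H (x + t • d) - H x - DH x₀ (t • d)) - (DH x (t • d) - DH x₀ (t • d)) := by
    rw [map_smul (DH x)]
    module
  have hbound : ‖H (x + t • d)‖ ≤ (1 - (1 - δ) * (1 / 2 + σ) * t) * ‖H x‖ := by
    have h4 : ‖H (x + t • d)‖ ≤ ‖(1 - t) • H x‖ + ‖t • (H x + DH x d)‖
        + ‖H (x + t • d) - H x - DH x₀ (t • d)‖ + ‖DH x (t • d) - DH x₀ (t • d)‖ := by
      conv_lhs => rw [hsplit]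
      exact (norm_sub_le _ _).trans
        (add_le_add_left ((norm_add_le _ _).trans (add_le_add_left (norm_add_le _ _) _)) _)
    have h5 : 2 * c * (t * ‖d‖) ≤ (1 - δ) * (1 / 2 - σ) * t * ‖H x‖ := by
      calc 2 * c * (t * ‖d‖) ≤ 2 * c * (t * B) := by gcongr
        _ = (2 * c * B) * t := by ring
        _ = (1 - δ) * (1 / 2 - σ) * t * (N / 2) := by rw [hcB]; ring
        _ ≤ _ := by
          refine mul_le_mul_of_nonneg_left hxlow.le ?_
          have h1 : 0 < 1 - δ := by linarith
          have h2 : 0 < 1 / 2 - σ := by linarith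
          positivity
    linarith
  have hs0 : 0 ≤ (1 - δ) * t := mul_nonneg (by linarith) ht.le
  have hs1 : (1 - δ) * t ≤ 1 := by nlinarith
  calc ‖H (x + t • d)‖ ^ 2 ≤ ((1 - (1 - δ) * (1 / 2 + σ) * t) * ‖H x‖) ^ 2 :=
        pow_le_pow_left₀ (norm_nonneg _) hbound 2
    _ = (1 - (1 - δ) * (1 / 2 + σ) * t) ^ 2 * ‖H x‖ ^ 2 := by ring
    _ ≤ _ := by
      refine mul_le_mul_of_nonneg_right ?_ (sq_nonneg _)
      -- With `p = (1 - δ) t ∈ [0, 1]` and `s = 1/2 + σ ≤ 1`: `(1 - s p)² ≤ 1 - 2 s p + p`.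
      have : ((1 - δ) * t) ^ 2 * (1 / 2 + σ) ^ 2 ≤ (1 - δ) * t * 1 := by
        rw [pow_two ((1 - δ) * t), mul_assoc]
        refine mul_le_mul_of_nonneg_left ?_ hs0
        exact mul_le_one₀ hs1 (sq_nonneg _) (pow_le_one₀ (by linarith) (by linarith))
      nlinarith

/-- A damped inexact Newton iteration cannot accumulate at a nonzero point of `H` with uniformly
invertible derivatives: near such a point every step reduces `‖H‖²` by a fixed fraction. -/
theorem eq_zero_of_mapClusterPt {H : V → V} {DH : V → V →L[ℝ] V} {x₀ : V}
    (hH : HasStrictFDerivAt H (DH x₀) x₀) (hDH : ContinuousAt DH x₀)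
    {M : ℝ} (hM : 0 < M) (hinv : ∀ᶠ x in 𝓝 x₀, ∀ y, ‖y‖ ≤ M * ‖DH x y‖)
    {δ σ ρ : ℝ} (hδ₀ : 0 ≤ δ) (hδ : δ < 1) (hσ₀ : 0 < σ) (hσ : σ < 1 / 2) (hρ₀ : 0 < ρ)
    (hρ : ρ < 1) {b d : ℕ → V} {ℓ : ℕ → ℕ}
    (hres : ∀ᶠ x in 𝓝 x₀, ∀ k, b k = x → ‖H x + DH x (d k)‖ ≤ δ * ‖H x‖)
    (hls : ∀ k, IsLeast {l : ℕ | ‖H (b k + ρ ^ l • d k)‖ ^ 2 ≤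
      (1 - 2 * σ * (1 - δ) * ρ ^ l) * ‖H (b k)‖ ^ 2} (ℓ k))
    (hupd : ∀ k, b (k + 1) = b k + ρ ^ ℓ k • d k) (hacc : MapClusterPt x₀ atTop b) :
    H x₀ = 0 := by
  by_contra hx₀
  obtain ⟨t₀, ht₀, hacp⟩ := exists_forall_step_accepted hH hDH hx₀ hM hinv hδ₀ hδ hσ₀ hσ
  obtain ⟨l₀, hl₀⟩ := exists_pow_lt_of_lt_one ht₀ hρ
  have hNpos : 0 < ‖H x₀‖ := norm_pos_iff.2 hx₀
  have hdec : ∀ k, ‖H (b (k + 1))‖ ^ 2 ≤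
      (1 - 2 * σ * (1 - δ) * ρ ^ ℓ k) * ‖H (b k)‖ ^ 2 := fun k => by
    rw [hupd k]; exact (hls k).1
  have hσδ : 0 < 2 * σ * (1 - δ) := by
    have : 0 < 1 - δ := by linarith
    positivity
  have hanti : Antitone fun k => ‖H (b k)‖ ^ 2 := by
    refine antitone_nat_of_succ_le fun k => (hdec k).trans ?_
    refine mul_le_of_le_one_left (sq_nonneg _) ?_
    have : 0 < 2 * σ * (1 - δ) * ρ ^ ℓ k := mul_pos hσδ (pow_pos hρ₀ _)
    linarith
  have hlim := tendsto_atTop_ciInf hanti ⟨0, by rintro _ ⟨k, rfl⟩; exact sq_nonneg _⟩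
  have hdiff : Tendsto (fun k => ‖H (b k)‖ ^ 2 - ‖H (b (k + 1))‖ ^ 2) atTop (𝓝 0) := by
    simpa using hlim.sub (hlim.comp (tendsto_add_atTop_nat 1))
  -- A lower bound for the decrease of `‖H‖²` in every step taken near `x₀`.
  set γ := 2 * σ * (1 - δ) * ρ ^ l₀ * (‖H x₀‖ / 2) ^ 2 with hγ
  have hγpos : 0 < γ := mul_pos (mul_pos hσδ (pow_pos hρ₀ _)) (by positivity)
  have hfreq : ∃ᶠ k in atTop, γ ≤ ‖H (b k)‖ ^ 2 - ‖H (b (k + 1))‖ ^ 2 := by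
    have hev : ∀ᶠ x in 𝓝 x₀, ∀ k, b k = x → γ ≤ ‖H (b k)‖ ^ 2 - ‖H (b (k + 1))‖ ^ 2 := by
      filter_upwards [hacp, hres,
        hH.continuousAt.norm.eventually (lt_mem_nhds (half_lt_self hNpos))] with x hx hxres hxlow
      rintro k rfl
      have hle : ℓ k ≤ l₀ := (hls k).2 (hx (d k) (hxres k rfl) _ (pow_pos hρ₀ _) hl₀.le)
      have hpow : ρ ^ l₀ ≤ ρ ^ ℓ k := pow_le_pow_of_le_one hρ₀.le hρ.le hle
      have hsq : (‖H x₀‖ / 2) ^ 2 ≤ ‖H (b k)‖ ^ 2 :=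
        pow_le_pow_left₀ (by positivity) hxlow.le 2
      have : γ ≤ 2 * σ * (1 - δ) * ρ ^ ℓ k * ‖H (b k)‖ ^ 2 := by
        rw [hγ]
        gcongr
      linarith [hdec k]
    exact (hacc.frequently hev).mono fun k hk => hk k rfl
  obtain ⟨k, hk1, hk2⟩ := (hfreq.and_eventually (hdiff.eventually (gt_mem_nhds hγpos))).exists
  exact absurd hk1 (not_le.2 hk2)

/-- One inexact Newton step near a zero `x₀` of `H`, on a set `S` on which `H` has a second-order
expansion at `x₀` along derivatives that are uniformly bounded and invertible (strong
semismoothness). The step has order `1 + τ` and reduces `‖H‖²` by any prescribed factor. -/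
theorem exists_forall_newton_step {H : V → V} {DH : V → V →L[ℝ] V} {x₀ : V} {S : Set V}
    (hx₀ : H x₀ = 0) {M L K c τ γ : ℝ} (hM : 0 < M) (hL : 0 ≤ L) (hK : 0 ≤ K) (hc : 0 ≤ c)
    (hτ₀ : 0 < τ) (hτ : τ ≤ 1) (hγ : 0 < γ)
    (hinv : ∀ᶠ x in 𝓝[S] x₀, ∀ y, ‖y‖ ≤ M * ‖DH x y‖)
    (hbdd : ∀ᶠ x in 𝓝[S] x₀, ‖DH x‖ ≤ L)
    (hexp : ∀ᶠ x in 𝓝[S] x₀, ‖H x - H x₀ - DH x (x - x₀)‖ ≤ K * ‖x - x₀‖ ^ 2) :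
    ∃ A : ℝ, ∀ᶠ x in 𝓝[S] x₀, ∀ d, x + d ∈ S → ‖H x + DH x d‖ ≤ c * ‖H x‖ ^ (1 + τ) →
      ‖x + d - x₀‖ ≤ A * ‖x - x₀‖ ^ (1 + τ) ∧ ‖x + d - x₀‖ ≤ 1 / 2 * ‖x - x₀‖ ∧
      ‖H (x + d)‖ ^ 2 ≤ γ * ‖H x‖ ^ 2 := by
  -- Near `x₀`, `‖H x‖` is bounded above (`hup`) and below (`hlow`) by multiples of `‖x - x₀‖`.
  have hup : ∀ᶠ x in 𝓝[S] x₀, ‖H x‖ ≤ (L + K) * ‖x - x₀‖ := by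
    filter_upwards [hbdd, hexp, mem_nhdsWithin_of_mem_nhds (Metric.ball_mem_nhds x₀ one_pos)]
      with x h1 h2 h3
    rw [Metric.mem_ball, dist_eq_norm] at h3
    have h4 : ‖H x‖ ≤ ‖H x - H x₀ - DH x (x - x₀)‖ + ‖DH x (x - x₀)‖ := by
      simpa [hx₀] using norm_add_le (H x - H x₀ - DH x (x - x₀)) (DH x (x - x₀))
    have h5 := ((DH x).le_opNorm (x - x₀)).trans
      (mul_le_mul_of_nonneg_right h1 (norm_nonneg _))
    have h6 : K * ‖x - x₀‖ ^ 2 ≤ K * ‖x - x₀‖ := by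
      refine mul_le_mul_of_nonneg_left ?_ hK
      nlinarith [norm_nonneg (x - x₀)]
    linarith
  have hsmall : ∀ ε : ℝ, 0 < ε → ∀ A : ℝ, 0 ≤ A → ∀ᶠ x in 𝓝[S] x₀, A * ‖x - x₀‖ ^ τ ≤ ε := by
    intro ε hε A hA
    have hcont : ContinuousAt (fun x => A * ‖x - x₀‖ ^ τ) x₀ := by
      have : ContinuousAt (fun x => ‖x - x₀‖) x₀ := by fun_prop
      exact continuousAt_const.mul (this.rpow_const (Or.inr hτ₀.le))
    have hval : A * ‖x₀ - x₀‖ ^ τ < ε := by simpa [Real.zero_rpow hτ₀.ne'] using hε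
    exact mem_nhdsWithin_of_mem_nhds ((hcont.eventually (gt_mem_nhds hval)).mono fun x h => h.le)
  have hsmall1 : ∀ ε : ℝ, 0 < ε → ∀ᶠ x in 𝓝[S] x₀, ‖x - x₀‖ ≤ ε := by
    intro ε hε
    filter_upwards [mem_nhdsWithin_of_mem_nhds (Metric.closedBall_mem_nhds x₀ hε)] with x hx
    rwa [Metric.mem_closedBall, dist_eq_norm] at hx
  have hlow : ∀ᶠ x in 𝓝[S] x₀, ‖x - x₀‖ ≤ 2 * M * ‖H x‖ := by
    filter_upwards [hinv, hexp, hsmall1 (1 / (2 * (M * K + 1))) (by positivity)] with x h1 h2 h3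
    have h4 : ‖DH x (x - x₀)‖ ≤ ‖H x‖ + ‖H x - H x₀ - DH x (x - x₀)‖ := by
      simpa [hx₀] using norm_sub_le (H x) (H x - H x₀ - DH x (x - x₀))
    have h5 : ‖x - x₀‖ ≤ M * (‖H x‖ + K * ‖x - x₀‖ ^ 2) :=
      (h1 _).trans (mul_le_mul_of_nonneg_left (by linarith) hM.le)
    have h6 : M * K * ‖x - x₀‖ ≤ 1 / 2 := by
      have h7 : ‖x - x₀‖ * (2 * (M * K + 1)) ≤ 1 := (le_div_iff₀ (by positivity)).1 h3
      nlinarith [norm_nonneg (x - x₀)]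
    nlinarith [norm_nonneg (x - x₀)]
  set A := M * (c * (L + K) ^ (1 + τ) + K) with hA
  have hA0 : 0 ≤ A := by positivity
  obtain ⟨U, hU, hUS⟩ := mem_nhdsWithin_iff_exists_mem_nhds_inter.1 hup
  obtain ⟨r, hr, hrU⟩ := Metric.mem_nhds_iff.1 hU
  -- The factor that makes the last estimate come out as `γ`.
  set β := √γ / ((L + K + 1) * (2 * M)) with hβ
  have hβ0 : 0 < β := by positivity
  refine ⟨A, ?_⟩
  filter_upwards [hup, hlow, hinv, hexp, hsmall (1 / 2) (by norm_num) A hA0, hsmall β hβ0 A hA0,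
    hsmall1 1 one_pos, hsmall1 (r / 2) (half_pos hr)]
    with x h1 h2 h3 h4 h5 h6 h7 h8 d hdS hd
  have hrate : ‖x + d - x₀‖ ≤ A * ‖x - x₀‖ ^ (1 + τ) := by
    have e1 : DH x (x + d - x₀) = (H x + DH x d) - (H x - H x₀ - DH x (x - x₀)) := by
      rw [hx₀, show x + d - x₀ = d + (x - x₀) by abel, map_add]
      abel
    have e2 : c * ‖H x‖ ^ (1 + τ) ≤ c * (L + K) ^ (1 + τ) * ‖x - x₀‖ ^ (1 + τ) := by
      rw [mul_assoc, ← Real.mul_rpow (by positivity) (norm_nonneg _)]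
      gcongr
    have e3 : ‖x - x₀‖ ^ 2 ≤ ‖x - x₀‖ ^ (1 + τ) := by
      rcases eq_or_ne (‖x - x₀‖) 0 with h0 | h0
      · rw [h0, Real.zero_rpow (by linarith)]; norm_num
      · rw [← Real.rpow_natCast]
        exact Real.rpow_le_rpow_of_exponent_ge ((norm_nonneg _).lt_of_ne' h0) h7
          (by norm_num; linarith)
    calc ‖x + d - x₀‖ ≤ M * ‖DH x (x + d - x₀)‖ := h3 _
      _ ≤ M * (c * ‖H x‖ ^ (1 + τ) + K * ‖x - x₀‖ ^ 2) := by
        rw [e1]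
        exact mul_le_mul_of_nonneg_left ((norm_sub_le _ _).trans (add_le_add hd h4)) hM.le
      _ ≤ M * (c * (L + K) ^ (1 + τ) * ‖x - x₀‖ ^ (1 + τ) + K * ‖x - x₀‖ ^ (1 + τ)) := by
        gcongr
      _ = A * ‖x - x₀‖ ^ (1 + τ) := by rw [hA]; ring
  have hpow : ‖x - x₀‖ ^ (1 + τ) = ‖x - x₀‖ ^ τ * ‖x - x₀‖ := by
    rw [add_comm, Real.rpow_add_of_nonneg (norm_nonneg _) hτ₀.le zero_le_one, Real.rpow_one]
  have hfac : ∀ ε : ℝ, A * ‖x - x₀‖ ^ τ ≤ ε → ‖x + d - x₀‖ ≤ ε * ‖x - x₀‖ := fun ε hε => by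
    refine hrate.trans ?_
    rw [hpow, ← mul_assoc]
    exact mul_le_mul_of_nonneg_right hε (norm_nonneg _)
  have hhalf := hfac _ h5
  refine ⟨hrate, hhalf, ?_⟩
  have hxd : ‖H (x + d)‖ ≤ (L + K) * ‖x + d - x₀‖ := by
    refine hUS ⟨hrU ?_, hdS⟩
    rw [Metric.mem_ball, dist_eq_norm]
    linarith [norm_nonneg (x - x₀)]
  have hfin : ‖H (x + d)‖ ≤ √γ * ‖H x‖ := by
    calc ‖H (x + d)‖ ≤ (L + K) * (β * (2 * M * ‖H x‖)) := by
          refine hxd.trans (mul_le_mul_of_nonneg_left ((hfac _ h6).trans ?_) (by positivity))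
          gcongr
      _ ≤ (L + K + 1) * (β * (2 * M * ‖H x‖)) :=
          mul_le_mul_of_nonneg_right (by linarith) (by positivity)
      _ = √γ * ‖H x‖ := by rw [hβ]; field_simp
  calc ‖H (x + d)‖ ^ 2 ≤ (√γ * ‖H x‖) ^ 2 := pow_le_pow_left₀ (norm_nonneg _) hfin 2
    _ = γ * ‖H x‖ ^ 2 := by rw [mul_pow, Real.sq_sqrt hγ.le]

end Newton

/-- A sequence in `S` that moves by contracting steps of order `1 + τ` whenever it is close to one
of its cluster points converges to it, with that order. -/
theorem tendsto_and_isBigO_of_local_contraction {V : Type*} [SeminormedAddCommGroup V] {x₀ : V}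
    {S : Set V} {A τ : ℝ}
    {b : ℕ → V} (hbS : ∀ k, b k ∈ S) (hacc : MapClusterPt x₀ atTop b) {p : ℕ → Prop}
    (hloc : ∀ᶠ x in 𝓝[S] x₀, ∀ k, b k = x → p k ∧
      ‖b (k + 1) - x₀‖ ≤ A * ‖b k - x₀‖ ^ (1 + τ) ∧ ‖b (k + 1) - x₀‖ ≤ 1 / 2 * ‖b k - x₀‖) :
    Tendsto b atTop (𝓝 x₀) ∧
      (fun k => b (k + 1) - x₀) =O[atTop] (fun k => ‖b k - x₀‖ ^ (1 + τ)) ∧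
      ∀ᶠ k in atTop, p k := by
  obtain ⟨U, hU, hUS⟩ := mem_nhdsWithin_iff_exists_mem_nhds_inter.1 hloc
  obtain ⟨r, hr, hrU⟩ := Metric.mem_nhds_iff.1 hU
  obtain ⟨k₀, hk₀⟩ := (hacc.frequently (Metric.ball_mem_nhds x₀ hr)).exists
  rw [dist_eq_norm] at hk₀
  have hstep : ∀ k, ‖b k - x₀‖ < r → _ := fun k hk =>
    hUS ⟨hrU (by rwa [Metric.mem_ball, dist_eq_norm]), hbS k⟩ k rfl
  have hgeo : ∀ m, ‖b (m + k₀) - x₀‖ ≤ (1 / 2) ^ m * ‖b k₀ - x₀‖ ∧ ‖b (m + k₀) - x₀‖ < r := by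
    intro m
    induction m with
    | zero => simpa using hk₀
    | succ m ih =>
      have h := (hstep (m + k₀) ih.2).2.2
      rw [show m + 1 + k₀ = m + k₀ + 1 by ring]
      constructor
      · rw [pow_succ]; linarith [ih.1]
      · linarith [ih.2, norm_nonneg (b (m + k₀) - x₀)]
  have hev : ∀ᶠ k in atTop, ‖b k - x₀‖ < r := by
    filter_upwards [eventually_ge_atTop k₀] with k hk
    simpa [Nat.sub_add_cancel hk] using (hgeo (k - k₀)).2
  refine ⟨?_, IsBigO.of_bound A ?_, hev.mono fun k hk => (hstep k hk).1⟩
  · rw [← tendsto_add_atTop_iff_nat k₀, tendsto_iff_norm_sub_tendsto_zero]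
    refine squeeze_zero (fun _ => norm_nonneg _) (fun m => (hgeo m).1) ?_
    simpa using (tendsto_pow_atTop_nhds_zero_of_lt_one (r := (1 / 2 : ℝ)) (by norm_num)
      (by norm_num)).mul_const ‖b k₀ - x₀‖
  · filter_upwards [hev] with k hk
    rw [Real.norm_of_nonneg (Real.rpow_nonneg (norm_nonneg _) _)]
    exact (hstep k hk).2.1

/-! ### Smooth maps with one Huber term -/

section HuberComposite

variable {V W : Type*} [NormedAddCommGroup V] [NormedSpace ℝ V]
  [NormedAddCommGroup W] [NormedSpace ℝ W]

/-- The derivative of `x ↦ F x - h(π x, θ x) • e` in terms of the slope `s` of the Huber function,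
with `s` detached from `x`. Unlike the derivative itself, this family depends continuously on
`(x, s)` also at the points with `π x = 0`. -/
def huberDeriv (F : V → W) (θ : V → ℝ) (π : V →L[ℝ] ℝ) (e : W) (x : V) (s : ℝ) : V →L[ℝ] W :=
  fderiv ℝ F x - (s • fderiv ℝ θ x - (s ^ 2 / 2) • π).smulRight e

variable {F H : V → W} {θ : V → ℝ} {π : V →L[ℝ] ℝ} {e : W}

theorem huberDeriv_apply (x : V) (s : ℝ) (y : V) :
    huberDeriv F θ π e x s y =
      fderiv ℝ F x y - (s * fderiv ℝ θ x y - s ^ 2 / 2 * π y) • e := by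
  simp [huberDeriv]

theorem continuous_huberDeriv (hF : ContDiff ℝ 2 F) (hθ : ContDiff ℝ 2 θ) :
    Continuous fun q : V × ℝ => huberDeriv F θ π e q.1 q.2 := by
  have h1 : Continuous (fderiv ℝ F) := hF.continuous_fderiv (by norm_num)
  have h2 : Continuous (fderiv ℝ θ) := hθ.continuous_fderiv (by norm_num)
  have h3 : Continuous fun q : V × ℝ =>
      q.2 • fderiv ℝ θ q.1 - (q.2 ^ 2 / 2) • π := by fun_prop
  exact (h1.comp continuous_fst).sub
    (((ContinuousLinearMap.smulRightL ℝ V W).flip e).continuous.comp h3)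

theorem exists_norm_huberDeriv_le (hF : ContDiff ℝ 2 F) (hθ : ContDiff ℝ 2 θ) (x₀ : V) :
    ∃ L : ℝ, 0 ≤ L ∧ ∀ᶠ x in 𝓝 x₀, ∀ s ∈ Set.Icc (0 : ℝ) 1, ‖huberDeriv F θ π e x s‖ ≤ L := by
  have h1 : Continuous (fderiv ℝ F) := hF.continuous_fderiv (by norm_num)
  have h2 : Continuous (fderiv ℝ θ) := hθ.continuous_fderiv (by norm_num)
  refine ⟨‖fderiv ℝ F x₀‖ + 1 + (‖fderiv ℝ θ x₀‖ + 1 + ‖π‖) * ‖e‖, by positivity, ?_⟩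
  filter_upwards [h1.continuousAt.norm.eventually (gt_mem_nhds (lt_add_one _)),
    h2.continuousAt.norm.eventually (gt_mem_nhds (lt_add_one _))] with x hx1 hx2
  rintro s ⟨hs0, hs1⟩
  refine (norm_sub_le _ _).trans (add_le_add hx1.le ?_)
  rw [ContinuousLinearMap.norm_smulRight_apply]
  refine mul_le_mul_of_nonneg_right ((norm_sub_le _ _).trans (add_le_add ?_ ?_)) (norm_nonneg _)
  · rw [norm_smul, Real.norm_of_nonneg hs0]
    exact (mul_le_of_le_one_left (norm_nonneg _) hs1).trans hx2.le
  · rw [norm_smul, Real.norm_of_nonneg (by positivity)]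
    exact mul_le_of_le_one_left (norm_nonneg _) (by nlinarith)

theorem hasFDerivAt_of_eq_sub_huber (hF : ContDiff ℝ 2 F) (hθ : ContDiff ℝ 2 θ)
    (hH : ∀ x, 0 ≤ π x → H x = F x - huber (π x) (θ x) • e) {x : V} (hx : 0 < π x) :
    HasFDerivAt H (huberDeriv F θ π e x (huberSlope (π x) (θ x))) x := by
  have hF' := (hF.differentiable (by norm_num) x).hasFDerivAt
  have hθ' := (hθ.differentiable (by norm_num) x).hasFDerivAt
  have hh := HasFDerivAt.comp (g := fun y : ℝ × ℝ => huber y.1 y.2) x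
    (hasFDerivAt_huber (x := (π x, θ x)) hx) (π.hasFDerivAt.prodMk hθ')
  have hd := hF'.sub (hh.smul_const e)
  have hpos : ∀ᶠ y in 𝓝 x, 0 < π y := π.continuous.continuousAt.eventually (lt_mem_nhds hx)
  refine (hd.congr_of_eventuallyEq (hpos.mono fun y hy => hH y hy.le)).congr_fderiv ?_
  ext y
  simp [huberDeriv, huberGrad_apply]

theorem continuousAt_huberDeriv (hF : ContDiff ℝ 2 F) (hθ : ContDiff ℝ 2 θ) {x : V}
    (hx : 0 < π x) :
    ContinuousAt (fun y => huberDeriv F θ π e y (huberSlope (π y) (θ y))) x := by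
  have h1 : ContinuousAt (fun y => huberSlope (π y) (θ y)) x :=
    ContinuousAt.comp (f := fun y => (π y, θ y)) (g := fun q : ℝ × ℝ => huberSlope q.1 q.2)
      (continuousAt_huberSlope (x := (π x, θ x)) hx)
      (π.continuous.prodMk hθ.continuous).continuousAt
  exact ContinuousAt.comp (f := fun y => (y, huberSlope (π y) (θ y)))
    (g := fun q : V × ℝ => huberDeriv F θ π e q.1 q.2)
    (continuous_huberDeriv hF hθ).continuousAt (continuousAt_id.prodMk h1)

theorem hasStrictFDerivAt_of_eq_sub_huber (hF : ContDiff ℝ 2 F) (hθ : ContDiff ℝ 2 θ)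
    (hH : ∀ x, 0 ≤ π x → H x = F x - huber (π x) (θ x) • e) {x : V} (hx : 0 < π x) :
    HasStrictFDerivAt H (huberDeriv F θ π e x (huberSlope (π x) (θ x))) x :=
  hasStrictFDerivAt_of_hasFDerivAt_of_continuousAt
    ((π.continuous.continuousAt.eventually (lt_mem_nhds hx)).mono fun _ hy =>
      hasFDerivAt_of_eq_sub_huber hF hθ hH hy)
    (continuousAt_huberDeriv hF hθ hx)

/-- Strong semismoothness of `x ↦ F x - h(π x, θ x) • e` at a point with `π x₀ = 0`: the Huber
function itself contributes no error, since its linearizations are exact at `(0, θ x₀)`. -/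
theorem exists_norm_sub_huberDeriv_le (hF : ContDiff ℝ 2 F) (hθ : ContDiff ℝ 2 θ)
    (hH : ∀ x, 0 ≤ π x → H x = F x - huber (π x) (θ x) • e) {x₀ : V} (hx₀ : π x₀ = 0) :
    ∃ K : ℝ, 0 ≤ K ∧ ∀ᶠ x in 𝓝[{x | 0 < π x}] x₀,
      ‖H x - H x₀ - huberDeriv F θ π e x (huberSlope (π x) (θ x)) (x - x₀)‖ ≤
        K * ‖x - x₀‖ ^ 2 := by
  obtain ⟨K₁, hK₁, h1⟩ := exists_norm_sub_fderiv_le hF x₀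
  obtain ⟨K₂, hK₂, h2⟩ := exists_norm_sub_fderiv_le hθ x₀
  have h3 : ∀ᶠ x in 𝓝 x₀, 0 < π x → huber (π x) (θ x) - huber 0 (θ x₀) =
      huberSlope (π x) (θ x) * (θ x - θ x₀) - huberSlope (π x) (θ x) ^ 2 / 2 * π x := by
    have hc : Tendsto (fun x => (π x, θ x)) (𝓝 x₀) (𝓝 ((0 : ℝ), θ x₀)) := by
      rw [← hx₀]
      exact (π.continuous.prodMk hθ.continuous).continuousAt
    exact hc.eventually (eventually_huber_sub_eq (θ x₀))
  refine ⟨K₁ + K₂ * ‖e‖, by positivity, ?_⟩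
  filter_upwards [mem_nhdsWithin_of_mem_nhds h1, mem_nhdsWithin_of_mem_nhds h2,
    mem_nhdsWithin_of_mem_nhds h3, self_mem_nhdsWithin] with x hx1 hx2 hx3 hx4
  have hx4 : 0 < π x := hx4
  obtain ⟨hs0, hs1⟩ := huberSlope_mem (π x) (θ x)
  have hx3 := hx3 hx4
  set s := huberSlope (π x) (θ x)
  have hsplit : H x - H x₀ - huberDeriv F θ π e x s (x - x₀) =
      (F x - F x₀ - fderiv ℝ F x (x - x₀)) -
        (s * (θ x - θ x₀ - fderiv ℝ θ x (x - x₀))) • e := by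
    have : (huber (π x) (θ x)) • e =
        (huber 0 (θ x₀) + (s * (θ x - θ x₀) - s ^ 2 / 2 * π x)) • e := by
      rw [← hx3]; congr 1; ring
    rw [hH x hx4.le, hH x₀ hx₀.ge, huberDeriv_apply, hx₀, this, map_sub π, hx₀]
    module
  rw [hsplit]
  refine (norm_sub_le _ _).trans ?_
  rw [norm_smul, norm_mul, Real.norm_of_nonneg hs0, add_mul]
  refine add_le_add hx1 ?_
  calc s * ‖θ x - θ x₀ - fderiv ℝ θ x (x - x₀)‖ * ‖e‖
      ≤ 1 * (K₂ * ‖x - x₀‖ ^ 2) * ‖e‖ := by gcongr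
    _ = _ := by ring

end HuberComposite

/-! ### Derivatives of the cross-validation data -/

theorem hasDerivAt_tanhHalf (x : ℝ) :
    HasDerivAt (fun x : ℝ => (1 - Real.exp (-x)) / (1 + Real.exp (-x)))
      (2 * (2 + Real.exp (-x) + Real.exp x)⁻¹) x := by
  have h1 := (hasDerivAt_neg x).exp
  have hpos : (1 : ℝ) + Real.exp (-x) ≠ 0 := by positivity
  have hpos2 : 2 + Real.exp (-x) + Real.exp x ≠ 0 := by positivity
  refine ((h1.const_sub 1).div (h1.const_add 1) hpos).congr_deriv ?_
  have he : Real.exp x * Real.exp (-x) = 1 := by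
    rw [← Real.exp_add, add_neg_cancel, Real.exp_zero]
  field_simp
  linear_combination 2 * he

theorem hasDerivAt_inv_one_add_exp (x : ℝ) :
    HasDerivAt (fun x : ℝ => (1 + Real.exp x)⁻¹) (-(Real.exp x / (1 + Real.exp x) ^ 2)) x := by
  have hpos : (1 : ℝ) + Real.exp x ≠ 0 := by positivity
  exact (((Real.hasDerivAt_exp x).const_add 1).inv hpos).congr_deriv (neg_div _ _)

theorem hasDerivAt_inv_two_add_exp_add_exp (x : ℝ) :
    HasDerivAt (fun x : ℝ => (2 + Real.exp (-x) + Real.exp x)⁻¹)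
      (Real.exp (-x) * (Real.exp (-x) - 1) / (1 + Real.exp (-x)) ^ 3) x := by
  have h1 := (hasDerivAt_neg x).exp
  have hpos2 : 2 + Real.exp (-x) + Real.exp x ≠ 0 := by positivity
  refine (((h1.const_add 2).fun_add (Real.hasDerivAt_exp x)).fun_inv hpos2).congr_deriv ?_
  rw [Real.exp_neg]
  have hx := Real.exp_pos x
  field_simp
  ring

section Curves

variable {ι ι' : Type*} [Fintype ι] [Fintype ι']

theorem hasDerivAt_mulVec (B : Matrix ι' ι ℝ) {f : ℝ → ι → ℝ} {f' : ι → ℝ} {t : ℝ}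
    (hf : HasDerivAt f f' t) : HasDerivAt (fun t => B *ᵥ f t) (B *ᵥ f') t :=
  (LinearMap.toContinuousLinearMap B.mulVecLin).hasFDerivAt.comp_hasDerivAt t hf

theorem hasDerivAt_dotProduct {f k : ℝ → ι → ℝ} {f' k' : ι → ℝ} {t : ℝ}
    (hf : HasDerivAt f f' t) (hk : HasDerivAt k k' t) :
    HasDerivAt (fun t => f t ⬝ᵥ k t) (f' ⬝ᵥ k t + f t ⬝ᵥ k') t := by
  rw [hasDerivAt_pi] at hf hk
  simp only [dotProduct, ← Finset.sum_add_distrib]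
  exact HasDerivAt.fun_sum fun i _ => (hf i).mul (hk i)

theorem contDiff_mulVec {V : Type*} [NormedAddCommGroup V] [NormedSpace ℝ V] {N : WithTop ℕ∞}
    (B : Matrix ι' ι ℝ) {f : V → ι → ℝ} (hf : ContDiff ℝ N f) :
    ContDiff ℝ N fun x => B *ᵥ f x :=
  (LinearMap.toContinuousLinearMap B.mulVecLin).contDiff.comp hf

theorem contDiff_dotProduct {V : Type*} [NormedAddCommGroup V] [NormedSpace ℝ V] {N : WithTop ℕ∞}
    {f k : V → ι → ℝ} (hf : ContDiff ℝ N f) (hk : ContDiff ℝ N k) :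
    ContDiff ℝ N fun x => f x ⬝ᵥ k x := by
  rw [contDiff_pi] at hf hk
  exact ContDiff.sum fun i _ => (hf i).mul (hk i)

end Curves

namespace CVData

variable {T m₁ m₂ n : ℕ} (D : CVData T m₁ m₂ n)

theorem hasDerivAt_g {w : ℝ → Fin n × Fin T → ℝ} {w' : Fin n × Fin T → ℝ} {t : ℝ}
    (hw : HasDerivAt w w' t) :
    HasDerivAt (fun t => D.g (w t)) (D.gradG (w t) *ᵥ w') t := by
  have hx : HasDerivAt (fun t => D.hX (w t) - D.yhatVec)
      ((2 : ℝ) • (diagonal (D.u (w t)) *ᵥ (D.Xᵀ *ᵥ w'))) t := by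
    refine HasDerivAt.sub_const _ (hasDerivAt_pi.2 fun i => ?_)
    have h := hasDerivAt_pi.1 (hasDerivAt_mulVec D.Xᵀ hw) i
    refine ((hasDerivAt_tanhHalf _).comp t h).congr_deriv ?_
    simp only [Pi.smul_apply, mulVec_diagonal, u, smul_eq_mul]
    ring
  refine ((hasDerivAt_mulVec D.X hx).const_smul (1 / 2 : ℝ)).congr_deriv ?_
  rw [mulVec_smul, smul_smul, gradG, ← mulVec_mulVec, ← mulVec_mulVec]
  norm_num

theorem hasDerivAt_gradF {w : ℝ → Fin n × Fin T → ℝ} {w' : Fin n × Fin T → ℝ} {t : ℝ}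
    (hw : HasDerivAt w w' t) :
    HasDerivAt (fun t => D.gradF (w t)) ((D.Aᵀ * diagonal (D.p (w t)) * D.A) *ᵥ w') t := by
  have hs : HasDerivAt (fun t => D.s (w t)) (-(diagonal (D.p (w t)) *ᵥ (D.A *ᵥ w'))) t := by
    refine hasDerivAt_pi.2 fun i => ?_
    have h := hasDerivAt_pi.1 (hasDerivAt_mulVec D.A hw) i
    refine ((hasDerivAt_inv_one_add_exp _).comp t h).congr_deriv ?_
    simp only [Pi.neg_apply, mulVec_diagonal, p]
    ring
  refine (hasDerivAt_mulVec D.Aᵀ hs).neg.congr_deriv ?_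
  rw [mulVec_neg, neg_neg, mulVec_mulVec, mulVec_mulVec]

theorem hasDerivAt_gradG_mulVec {w m : ℝ → Fin n × Fin T → ℝ} {w' m' : Fin n × Fin T → ℝ} {t : ℝ}
    (hw : HasDerivAt w w' t) (hm : HasDerivAt m m' t) :
    HasDerivAt (fun t => D.gradG (w t) *ᵥ m t)
      (D.gradG (w t) *ᵥ m' +
        (D.X * diagonal (D.Xᵀ *ᵥ m t) * diagonal (D.q (w t)) * D.Xᵀ) *ᵥ w') t := by
  have hu : HasDerivAt (fun t => diagonal (D.u (w t)) *ᵥ (D.Xᵀ *ᵥ m t))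
      (diagonal (D.u (w t)) *ᵥ (D.Xᵀ *ᵥ m') +
        diagonal (D.Xᵀ *ᵥ m t) *ᵥ (diagonal (D.q (w t)) *ᵥ (D.Xᵀ *ᵥ w'))) t := by
    refine hasDerivAt_pi.2 fun i => ?_
    have h1 := hasDerivAt_pi.1 (hasDerivAt_mulVec D.Xᵀ hw) i
    have h2 := hasDerivAt_pi.1 (hasDerivAt_mulVec D.Xᵀ hm) i
    have h3 := ((hasDerivAt_inv_two_add_exp_add_exp _).comp t h1).mul h2
    simp only [mulVec_diagonal, Pi.add_apply]
    refine h3.congr_deriv ?_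
    simp only [u, q, Function.comp_apply]
    ring
  have h := hasDerivAt_mulVec D.X hu
  simp only [mulVec_add, mulVec_mulVec, ← Matrix.mul_assoc] at h
  exact h

section Smooth

variable {V : Type*} [NormedAddCommGroup V] [NormedSpace ℝ V] {N : WithTop ℕ∞}
  {w m : V → Fin n × Fin T → ℝ}

theorem contDiff_g (hw : ContDiff ℝ N w) : ContDiff ℝ N fun x => D.g (w x) := by
  refine (contDiff_mulVec D.X (ContDiff.sub (contDiff_pi.2 fun i => ?_) contDiff_const)).const_smul
    (1 / 2 : ℝ)
  have h := (contDiff_pi.1 (contDiff_mulVec D.Xᵀ hw) i).neg.exp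
  exact (contDiff_const.sub h).div (contDiff_const.add h) fun x => by positivity

theorem contDiff_gradF (hw : ContDiff ℝ N w) : ContDiff ℝ N fun x => D.gradF (w x) := by
  refine (contDiff_mulVec D.Aᵀ (contDiff_pi.2 fun i => ?_)).neg
  have h := (contDiff_pi.1 (contDiff_mulVec D.A hw) i).exp
  exact (contDiff_const.add h).inv fun x => by positivity

theorem contDiff_gradG_mulVec (hw : ContDiff ℝ N w) (hm : ContDiff ℝ N m) :
    ContDiff ℝ N fun x => D.gradG (w x) *ᵥ m x := by
  simp only [gradG, ← mulVec_mulVec]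
  refine contDiff_mulVec D.X (contDiff_pi.2 fun i => ?_)
  simp only [mulVec_diagonal]
  have h := contDiff_pi.1 (contDiff_mulVec D.Xᵀ hw) i
  refine ContDiff.mul ?_ (contDiff_pi.1 (contDiff_mulVec D.Xᵀ hm) i)
  exact ((contDiff_const.add h.neg.exp).add h.exp).inv fun x => by positivity

end Smooth

end CVData

/-! ### The Newton system -/

namespace State

/-- The coordinate `ε` as a continuous linear functional. -/
def epsL (T n : ℕ) : State T n →L[ℝ] ℝ := WithLp.fstL 2 ℝ ℝ (Triple T n)

/-- The coordinate `C` as a continuous linear functional. -/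
def CL (T n : ℕ) : State T n →L[ℝ] ℝ :=
  WithLp.fstL 2 ℝ ℝ _ ∘L WithLp.sndL 2 ℝ ℝ (Triple T n)

/-- The coordinate `μ` as a continuous linear map. -/
def muL (T n : ℕ) : State T n →L[ℝ] (Fin n × Fin T → ℝ) :=
  (EuclideanSpace.equiv (Fin n × Fin T) ℝ).toContinuousLinearMap ∘L
    WithLp.fstL 2 ℝ (Vec T n) (Vec T n) ∘L WithLp.sndL 2 ℝ ℝ _ ∘L WithLp.sndL 2 ℝ ℝ (Triple T n)

/-- The coordinate `w` as a continuous linear map. -/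
def wL (T n : ℕ) : State T n →L[ℝ] (Fin n × Fin T → ℝ) :=
  (EuclideanSpace.equiv (Fin n × Fin T) ℝ).toContinuousLinearMap ∘L
    WithLp.sndL 2 ℝ (Vec T n) (Vec T n) ∘L WithLp.sndL 2 ℝ ℝ _ ∘L WithLp.sndL 2 ℝ ℝ (Triple T n)

/-- The unit vector of the coordinate `C`. -/
def unitC (T n : ℕ) : State T n := WithLp.toLp 2 (0, WithLp.toLp 2 (1, 0))

end State

namespace CVData

variable {T m₁ m₂ n : ℕ} (D : CVData T m₁ m₂ n)

open State

/-- The smooth part of `𝓔̂` on the half space `ε ≥ 0`: `𝓔̂` without the Huber term, and with `ε` in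
place of `|ε|`. -/
def smoothPart (κ : ℝ) (b : State T n) : State T n :=
  WithLp.toLp 2 (b.eps, WithLp.toLp 2 ((1 + κ * b.eps) * b.C, (D.E κ b).snd))

/-- The argument `θ(b) = C - μᵀ g(w)` of the Huber term. -/
def huberArg (b : State T n) : ℝ := b.C - b.mu ⬝ᵥ D.g b.w

theorem Ehat_eq (κ : ℝ) (b : State T n) (hb : 0 ≤ epsL T n b) :
    D.Ehat κ b = D.smoothPart κ b - huber (epsL T n b) (D.huberArg b) • unitC T n := by
  have hb : 0 ≤ b.eps := hb
  have h : epsL T n b = b.eps := rfl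
  rw [h]
  refine WithLp.ofLp_injective 2 (Prod.ext ?_ ?_)
  · simp [Ehat, smoothPart, unitC]
  · refine WithLp.ofLp_injective 2 (Prod.ext ?_ ?_)
    · simp [Ehat, smoothPart, unitC, E, huberArg, abs_of_nonneg hb]
    · simp [Ehat, smoothPart, unitC, E]

theorem contDiff_huberArg {N : WithTop ℕ∞} : ContDiff ℝ N D.huberArg :=
  (CL T n).contDiff.sub
    (contDiff_dotProduct (muL T n).contDiff (D.contDiff_g (wL T n).contDiff))

theorem contDiff_smoothPart {N : WithTop ℕ∞} (κ : ℝ) : ContDiff ℝ N (D.smoothPart κ) := by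
  have he := (epsL T n).contDiff (n := N)
  have hC := (CL T n).contDiff (n := N)
  have hm := (muL T n).contDiff (n := N)
  have hw := (wL T n).contDiff (n := N)
  refine WithLp.contDiff_toLp.comp (he.prodMk (WithLp.contDiff_toLp.comp
    (((contDiff_const.add (contDiff_const.mul he)).mul hC).prodMk
      (WithLp.contDiff_toLp.comp (ContDiff.prodMk (PiLp.contDiff_toLp.comp ?_)
        (PiLp.contDiff_toLp.comp ?_))))))
  · have h := ((D.contDiff_gradF hw).const_smul (1 / ((T : ℝ) * m₁))).add
      (hm.add (hC.smul (D.contDiff_gradG_mulVec hw hm)))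
    convert h using 2 with b
    rw [add_mulVec, one_mulVec, smul_mulVec]
    rfl
  · exact hw.add (hC.smul (D.contDiff_g hw))

/-- The four blocks of the Jacobian of the smooth part, read off along the line `b + t y`. -/
theorem fderiv_smoothPart (κ : ℝ) (b y : State T n) :
    epsL T n (fderiv ℝ (D.smoothPart κ) b y) = y.eps ∧
    CL T n (fderiv ℝ (D.smoothPart κ) b y) = κ * y.eps * b.C + (1 + κ * b.eps) * y.C ∧
    muL T n (fderiv ℝ (D.smoothPart κ) b y) =
      D.alpha b.mu b.C b.w *ᵥ y.w + y.C • (D.gradG b.w *ᵥ b.mu) + D.P b.C b.w *ᵥ y.mu ∧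
    wL T n (fderiv ℝ (D.smoothPart κ) b y) = D.P b.C b.w *ᵥ y.w + y.C • D.g b.w := by
  have hF := ((D.contDiff_smoothPart κ (N := 1)).differentiable (by norm_num) b).hasFDerivAt
  have he : HasDerivAt (fun t : ℝ => epsL T n (b + t • y)) (epsL T n y) 0 :=
    (epsL T n).hasFDerivAt.hasLineDerivAt y
  have hC : HasDerivAt (fun t : ℝ => CL T n (b + t • y)) (CL T n y) 0 :=
    (CL T n).hasFDerivAt.hasLineDerivAt y
  have hm : HasDerivAt (fun t : ℝ => muL T n (b + t • y)) (muL T n y) 0 :=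
    (muL T n).hasFDerivAt.hasLineDerivAt y
  have hw : HasDerivAt (fun t : ℝ => wL T n (b + t • y)) (wL T n y) 0 :=
    (wL T n).hasFDerivAt.hasLineDerivAt y
  have e0 : epsL T n (b + (0 : ℝ) • y) = b.eps := by simp; rfl
  have C0 : CL T n (b + (0 : ℝ) • y) = b.C := by simp; rfl
  have m0 : muL T n (b + (0 : ℝ) • y) = b.mu := by simp; rfl
  have w0 : wL T n (b + (0 : ℝ) • y) = b.w := by simp; rfl
  refine ⟨?_, ?_, ?_, ?_⟩
  · exact (((epsL T n).hasFDerivAt.comp b hF).hasLineDerivAt y).unique he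
  · refine (((CL T n).hasFDerivAt.comp b hF).hasLineDerivAt y).unique ?_
    refine (((he.const_mul κ).const_add 1).mul hC).congr_deriv ?_
    rw [e0, C0]
    rfl
  · refine (((muL T n).hasFDerivAt.comp b hF).hasLineDerivAt y).unique ?_
    have h := ((D.hasDerivAt_gradF hw).const_smul (1 / ((T : ℝ) * m₁))).add
      (hm.add (hC.smul (D.hasDerivAt_gradG_mulVec hw hm)))
    rw [C0, m0, w0] at h
    refine (h.congr_deriv ?_).congr_of_eventuallyEq (.of_forall fun t => ?_)
    · simp only [alpha, P, add_mulVec, smul_mulVec, one_mulVec, smul_add,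
        show muL T n y = y.mu from rfl, show wL T n y = y.w from rfl, show CL T n y = y.C from rfl]
      abel
    · change (1 / ((T : ℝ) * m₁)) • D.gradF (wL T n (b + t • y)) +
        (1 + CL T n (b + t • y) • D.gradG (wL T n (b + t • y))) *ᵥ muL T n (b + t • y) = _
      rw [add_mulVec, one_mulVec, smul_mulVec]
      rfl
  · refine (((wL T n).hasFDerivAt.comp b hF).hasLineDerivAt y).unique ?_
    refine (hw.add (hC.smul (D.hasDerivAt_g hw))).congr_deriv ?_
    rw [C0, w0, P, add_mulVec, one_mulVec, smul_mulVec, add_assoc]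
    rfl

theorem fderiv_huberArg (b y : State T n) :
    fderiv ℝ D.huberArg b y =
      y.C - (y.mu ⬝ᵥ D.g b.w + b.mu ⬝ᵥ (D.gradG b.w *ᵥ y.w)) := by
  have hθ := ((D.contDiff_huberArg (N := 1)).differentiable
    (by norm_num) b).hasFDerivAt.hasLineDerivAt y
  have hC : HasDerivAt (fun t : ℝ => CL T n (b + t • y)) (CL T n y) 0 :=
    (CL T n).hasFDerivAt.hasLineDerivAt y
  have hm : HasDerivAt (fun t : ℝ => muL T n (b + t • y)) (muL T n y) 0 :=
    (muL T n).hasFDerivAt.hasLineDerivAt y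
  have hw : HasDerivAt (fun t : ℝ => wL T n (b + t • y)) (wL T n y) 0 :=
    (wL T n).hasFDerivAt.hasLineDerivAt y
  have m0 : muL T n (b + (0 : ℝ) • y) = b.mu := by simp; rfl
  have w0 : wL T n (b + (0 : ℝ) • y) = b.w := by simp; rfl
  refine hθ.unique ((hC.sub (hasDerivAt_dotProduct hm (D.hasDerivAt_g hw))).congr_deriv ?_)
  rw [m0, w0]
  rfl

theorem gradG_transpose (w : Fin n × Fin T → ℝ) : (D.gradG w)ᵀ = D.gradG w := by
  simp [gradG, Matrix.transpose_mul, Matrix.mul_assoc]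

theorem P_transpose (C : ℝ) (w : Fin n × Fin T → ℝ) : (D.P C w)ᵀ = D.P C w := by
  simp [P, gradG_transpose]

theorem isUnit_det_P_of_z_pos {mu : Fin n × Fin T → ℝ} {C : ℝ} {w : Fin n × Fin T → ℝ}
    (hz : 0 < D.z mu C w) : IsUnit (D.P C w).det := by
  by_contra h
  rw [z, nonsing_inv_apply_not_isUnit _ h] at hz
  simp at hz

/-- Block elimination: eliminating `w` and `μ` from the Newton system leaves the coefficient
`1 - s + κ ε + s z(μ, v)` for `C`, which is positive for every slope `s ∈ [0, 1]` if
`z(μ, v) > 0`. -/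
theorem eq_zero_of_huberDeriv_eq_zero {κ : ℝ} (hκ : 0 < κ) {b : State T n} (hb : 0 ≤ b.eps)
    (hz : 0 < D.z b.mu b.C b.w) {s : ℝ} (hs : s ∈ Set.Icc (0 : ℝ) 1) {y : State T n}
    (hy : huberDeriv (D.smoothPart κ) D.huberArg (epsL T n) (unitC T n) b s y = 0) : y = 0 := by
  obtain ⟨he, hC, hm, hw⟩ := D.fderiv_smoothPart κ b y
  rw [huberDeriv_apply, sub_eq_zero] at hy
  have ue : epsL T n (unitC T n) = 0 := rfl
  have uC : CL T n (unitC T n) = 1 := rfl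
  have um : muL T n (unitC T n) = 0 := rfl
  have uw : wL T n (unitC T n) = 0 := rfl
  have ye : y.eps = 0 := by rw [← he, hy, map_smul, ue, smul_zero]
  rw [hy, map_smul, uC, smul_eq_mul, mul_one, D.fderiv_huberArg, show epsL T n y = 0 from ye,
    ye] at hC
  rw [hy, map_smul, um, smul_zero] at hm
  rw [hy, map_smul, uw, smul_zero] at hw
  have hP := D.isUnit_det_P_of_z_pos hz
  set g := D.g b.w
  set G := D.gradG b.w
  set P := D.P b.C b.w with hPdef
  set α := D.alpha b.mu b.C b.w
  have yw : y.w = -(y.C • (P⁻¹ *ᵥ g)) := by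
    have h : P *ᵥ y.w = -(y.C • g) := eq_neg_of_add_eq_zero_left hw.symm
    rw [← mulVec_smul, ← mulVec_neg, ← h, mulVec_mulVec, nonsing_inv_mul _ hP, one_mulVec]
  have ym : y.mu = y.C • (P⁻¹ *ᵥ (α *ᵥ (P⁻¹ *ᵥ g) - G *ᵥ b.mu)) := by
    have h : P *ᵥ y.mu = y.C • (α *ᵥ (P⁻¹ *ᵥ g) - G *ᵥ b.mu) := by
      have h' := eq_neg_of_add_eq_zero_right hm.symm
      rw [h', yw, mulVec_neg, mulVec_smul]
      module
    rw [← mulVec_smul, ← h, mulVec_mulVec, nonsing_inv_mul _ hP, one_mulVec]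
  have hsymm : b.mu ⬝ᵥ (G *ᵥ (P⁻¹ *ᵥ g)) = g ⬝ᵥ (P⁻¹ *ᵥ (G *ᵥ b.mu)) := by
    have hGt : Gᵀ = G := D.gradG_transpose b.w
    have hPt : (P⁻¹)ᵀ = P⁻¹ := by rw [transpose_nonsing_inv, hPdef, D.P_transpose]
    rw [dotProduct_mulVec, ← mulVec_transpose, hGt, dotProduct_mulVec, ← mulVec_transpose, hPt,
      dotProduct_comm]
  have hzdef : D.z b.mu b.C b.w =
      g ⬝ᵥ (P⁻¹ *ᵥ (α *ᵥ (P⁻¹ *ᵥ g))) - 2 * (g ⬝ᵥ (P⁻¹ *ᵥ (G *ᵥ b.mu))) := by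
    rw [z, mulVec_sub, dotProduct_sub, mulVec_smul, dotProduct_smul, smul_eq_mul]
  have hcoef : y.C * (1 - s + κ * b.eps + s * D.z b.mu b.C b.w) = 0 := by
    rw [dotProduct_comm y.mu, ym, yw, mulVec_neg, mulVec_smul, dotProduct_neg, dotProduct_smul,
      dotProduct_smul, hsymm, mulVec_sub, dotProduct_sub] at hC
    simp only [smul_eq_mul] at hC
    rw [hzdef]
    linear_combination -hC
  have hpos : 0 < 1 - s + κ * b.eps + s * D.z b.mu b.C b.w := by
    obtain ⟨h0, h1⟩ := hs
    have hκe : 0 ≤ κ * b.eps := mul_nonneg hκ.le hb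
    rcases h1.lt_or_eq with h | rfl
    · have := mul_nonneg h0 hz.le
      linarith
    · linarith
  have yC : y.C = 0 := (mul_eq_zero.1 hcoef).resolve_right hpos.ne'
  rw [yC, zero_smul] at ym
  rw [yC, zero_smul, neg_zero] at yw
  refine WithLp.ofLp_injective 2 (Prod.ext ye ?_)
  refine WithLp.ofLp_injective 2 (Prod.ext yC ?_)
  refine WithLp.ofLp_injective 2 (Prod.ext ?_ ?_)
  · exact WithLp.ofLp_injective 2 ym
  · exact WithLp.ofLp_injective 2 yw

/-- The derivative of `𝓔̂` at the points with `ε > 0`, as a family on the whole space. -/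
def newtonDeriv (κ : ℝ) (b : State T n) : State T n →L[ℝ] State T n :=
  huberDeriv (D.smoothPart κ) D.huberArg (epsL T n) (unitC T n) b
    (huberSlope (epsL T n b) (D.huberArg b))

theorem fderiv_E_apply (κ : ℝ) {b : State T n} (hb : 0 < b.eps) (y : State T n) :
    fderiv ℝ (D.E κ) b y = (D.newtonDeriv κ b y).snd := by
  have h := hasFDerivAt_of_eq_sub_huber (D.contDiff_smoothPart κ) D.contDiff_huberArg
    (D.Ehat_eq κ) (x := b) hb
  have h2 := (WithLp.sndL 2 ℝ ℝ (Triple T n)).hasFDerivAt.comp b h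
  rw [show D.E κ = ⇑(WithLp.sndL 2 ℝ ℝ (Triple T n)) ∘ D.Ehat κ from rfl, h2.fderiv]
  rfl

theorem newtonDeriv_apply_fst (κ : ℝ) (b y : State T n) :
    (D.newtonDeriv κ b y).fst = y.eps := by
  have h := (D.fderiv_smoothPart κ b y).1
  have : epsL T n (D.newtonDeriv κ b y) = y.eps := by
    rw [newtonDeriv, huberDeriv_apply, map_sub, h, map_smul, show epsL T n (unitC T n) = 0 from rfl,
      smul_zero, sub_zero]
  exact this

theorem Ehat_add_newtonDeriv (κ : ℝ) {b : State T n} (hb : 0 < b.eps) (y : State T n) :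
    D.Ehat κ b + D.newtonDeriv κ b y = WithLp.toLp 2 (b.eps + y.eps, residual D κ b y) := by
  refine WithLp.ofLp_injective 2 (Prod.ext ?_ ?_)
  · change b.eps + (D.newtonDeriv κ b y).fst = _
    rw [newtonDeriv_apply_fst]
  · change D.E κ b + (D.newtonDeriv κ b y).snd = _
    rw [← D.fderiv_E_apply κ hb]
    rfl

end CVData

/-! ### The iterates of the algorithm -/

namespace Params

variable {T m₁ m₂ n : ℕ} (Q : Params) (D : CVData T m₁ m₂ n)

theorem zeta_pos {b : State T n} (hb : D.Ehat Q.κ b ≠ 0) : 0 < Q.zeta D b :=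
  mul_pos Q.r_mem.1 (lt_min one_pos (Real.rpow_pos_of_pos (norm_pos_iff.2 hb) _))

theorem zeta_le (b : State T n) : Q.zeta D b ≤ Q.r * ‖D.Ehat Q.κ b‖ := by
  refine mul_le_mul_of_nonneg_left ?_ Q.r_mem.1.le
  rcases le_total ‖D.Ehat Q.κ b‖ 1 with h | h
  · refine (min_le_right _ _).trans ?_
    rcases eq_or_ne ‖D.Ehat Q.κ b‖ 0 with h0 | h0
    · rw [h0, Real.zero_rpow (by linarith [Q.τ_mem.1])]
    · exact Real.rpow_le_self_of_le_one ((norm_nonneg _)) h (by linarith [Q.τ_mem.1])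
  · exact (min_le_left _ _).trans h

theorem delta_nonneg : 0 ≤ Q.delta :=
  mul_nonneg (Real.sqrt_nonneg _) (Q.etaHat_pos.le.trans (le_max_right _ _))

end Params

namespace IsRun

variable {T m₁ m₂ n : ℕ} {D : CVData T m₁ m₂ n} {Q : Params} {b d : ℕ → State T n} {ℓ : ℕ → ℕ}

theorem eps_succ (h : IsRun D Q b d ℓ) (k : ℕ) :
    (b (k + 1)).eps = (1 - Q.ρ ^ ℓ k) * (b k).eps + Q.ρ ^ ℓ k * (Q.zeta D (b k) * Q.epsHat) := by
  have : (b (k + 1)).eps = (b k).eps + Q.ρ ^ ℓ k * (d k).eps := by rw [h.update k]; rfl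
  rw [this, h.eps_step k]
  ring

theorem min_le_eps (h : IsRun D Q b d ℓ) {m : ℝ} (hm : ∀ k, m ≤ Q.zeta D (b k) * Q.epsHat)
    (k : ℕ) : min (b 0).eps m ≤ (b k).eps := by
  induction k with
  | zero => exact min_le_left _ _
  | succ k ih =>
    have h1 : Q.ρ ^ ℓ k ≤ 1 := pow_le_one₀ Q.ρ_mem.1.le Q.ρ_mem.2.le
    have h0 : 0 ≤ Q.ρ ^ ℓ k := pow_nonneg Q.ρ_mem.1.le _
    have hmin : min (b 0).eps m ≤ Q.zeta D (b k) * Q.epsHat := (min_le_right _ _).trans (hm k)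
    rw [h.eps_succ k]
    nlinarith [mul_le_mul_of_nonneg_left ih (sub_nonneg.2 h1), mul_le_mul_of_nonneg_left hmin h0]

theorem eps_pos (h : IsRun D Q b d ℓ) (k : ℕ) : 0 < (b k).eps := by
  induction k with
  | zero => exact h.eps_zero_pos
  | succ k ih =>
    have h1 : Q.ρ ^ ℓ k ≤ 1 := pow_le_one₀ Q.ρ_mem.1.le Q.ρ_mem.2.le
    have h0 : 0 < Q.ρ ^ ℓ k := pow_pos Q.ρ_mem.1 _
    have hζ := mul_pos (Q.zeta_pos D (h.not_solved k)) Q.epsHat_pos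
    rw [h.eps_succ k]
    exact add_pos_of_nonneg_of_pos (mul_nonneg (sub_nonneg.2 h1) ih.le) (mul_pos h0 hζ)

theorem antitone_norm (h : IsRun D Q b d ℓ) : Antitone fun k => ‖D.Ehat Q.κ (b k)‖ := by
  refine antitone_nat_of_succ_le fun k => ?_
  have hls : D.psi Q.κ (b (k + 1)) ≤
      (1 - 2 * Q.σ * (1 - Q.delta) * Q.ρ ^ ℓ k) * D.psi Q.κ (b k) := by
    rw [h.update k]; exact (h.line_search k).1
  have hpos : 0 ≤ 2 * Q.σ * (1 - Q.delta) * Q.ρ ^ ℓ k := by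
    have h1 : 0 ≤ 1 - Q.delta := sub_nonneg.2 Q.delta_lt_one.le
    have h2 := Q.σ_mem.1
    have h3 := Q.ρ_mem.1
    positivity
  have : D.psi Q.κ (b (k + 1)) ≤ D.psi Q.κ (b k) :=
    hls.trans (mul_le_of_le_one_left (sq_nonneg _) (by linarith))
  exact le_of_sq_le_sq this (norm_nonneg _)

theorem norm_Ehat_add_sq (h : IsRun D Q b d ℓ) (k : ℕ) :
    ‖D.Ehat Q.κ (b k) + D.newtonDeriv Q.κ (b k) (d k)‖ ^ 2 =
      (Q.zeta D (b k) * Q.epsHat) ^ 2 + ‖residual D Q.κ (b k) (d k)‖ ^ 2 := by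
  rw [D.Ehat_add_newtonDeriv Q.κ (h.eps_pos k), WithLp.prod_norm_sq_eq_of_L2, h.eps_step k]
  simp [mul_pow]

/-- The linear system is solved with relative accuracy `δ`. -/
theorem norm_Ehat_add_le (h : IsRun D Q b d ℓ) (k : ℕ) :
    ‖D.Ehat Q.κ (b k) + D.newtonDeriv Q.κ (b k) (d k)‖ ≤ Q.delta * ‖D.Ehat Q.κ (b k)‖ := by
  refine le_of_sq_le_sq ?_ (mul_nonneg Q.delta_nonneg (norm_nonneg _))
  rw [h.norm_Ehat_add_sq k]
  have hx := norm_nonneg (D.Ehat Q.κ (b k))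
  set m := max (Q.r * Q.epsHat) Q.etaHat with hm
  have h1 : Q.zeta D (b k) * Q.epsHat ≤ m * ‖D.Ehat Q.κ (b k)‖ := by
    calc Q.zeta D (b k) * Q.epsHat ≤ Q.r * ‖D.Ehat Q.κ (b k)‖ * Q.epsHat :=
          mul_le_mul_of_nonneg_right (Q.zeta_le D _) Q.epsHat_pos.le
      _ = Q.r * Q.epsHat * ‖D.Ehat Q.κ (b k)‖ := by ring
      _ ≤ _ := mul_le_mul_of_nonneg_right (le_max_left _ _) hx
  have h2 : ‖residual D Q.κ (b k) (d k)‖ ≤ m * ‖D.Ehat Q.κ (b k)‖ :=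
    (h.residual_le_etaHat k).trans (mul_le_mul_of_nonneg_right (le_max_right _ _) hx)
  have h3 := pow_le_pow_left₀
    (mul_pos (Q.zeta_pos D (h.not_solved k)) Q.epsHat_pos).le h1 2
  have h4 := pow_le_pow_left₀ (norm_nonneg _) h2 2
  have h5 : (Q.delta * ‖D.Ehat Q.κ (b k)‖) ^ 2 = 2 * (m * ‖D.Ehat Q.κ (b k)‖) ^ 2 := by
    rw [Params.delta, mul_assoc, mul_pow √2, Real.sq_sqrt zero_le_two]
  linarith

/-- Where the derivatives are bounded, the linear system is solved with accuracy of order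
`1 + τ`. -/
theorem norm_Ehat_add_le_rpow (h : IsRun D Q b d ℓ) (k : ℕ) {L : ℝ}
    (hL : ‖D.newtonDeriv Q.κ (b k)‖ ≤ L) :
    ‖D.Ehat Q.κ (b k) + D.newtonDeriv Q.κ (b k) (d k)‖ ≤
      (Q.r * Q.epsHat + Q.rHat * (1 + (1 + Q.r * Q.epsHat) * L)) *
        ‖D.Ehat Q.κ (b k)‖ ^ (1 + Q.τ) := by
  set x := ‖D.Ehat Q.κ (b k)‖ with hx
  have hx0 : 0 < x := norm_pos_iff.2 (h.not_solved k)
  have hL0 : 0 ≤ L := (norm_nonneg _).trans hL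
  have hr := Q.r_mem.1
  have he := Q.epsHat_pos
  have hrH := Q.rHat_pos
  have hpow : x ^ (1 + Q.τ) = x ^ Q.τ * x := by
    rw [add_comm, Real.rpow_add hx0, Real.rpow_one]
  have hζ : Q.zeta D (b k) * Q.epsHat ≤ Q.r * Q.epsHat * x ^ (1 + Q.τ) := by
    have : Q.zeta D (b k) ≤ Q.r * x ^ (1 + Q.τ) :=
      mul_le_mul_of_nonneg_left (min_le_right _ _) hr.le
    nlinarith
  have hζ0 : 0 < Q.zeta D (b k) * Q.epsHat := mul_pos (Q.zeta_pos D (h.not_solved k)) he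
  have hE : ‖D.E Q.κ (b k)‖ ≤ x := WithLp.norm_snd_le _ (D.Ehat Q.κ (b k))
  have heps : (b k).eps ≤ x :=
    (le_abs_self _).trans (WithLp.norm_fst_le _ (D.Ehat Q.κ (b k)))
  have hde : |(d k).eps| ≤ (1 + Q.r * Q.epsHat) * x := by
    have h1 := mul_le_mul_of_nonneg_right (Q.zeta_le D (b k)) he.le
    have h2 := h.eps_pos k
    rw [h.eps_step k, abs_le]
    have h3 : 0 ≤ Q.r * Q.epsHat * x := by positivity
    constructor <;> linarith
  have hpart : ‖partialEps D Q.κ (b k)‖ ≤ L := by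
    rw [partialEps, D.fderiv_E_apply Q.κ (h.eps_pos k)]
    refine (WithLp.norm_snd_le _ _).trans (((D.newtonDeriv Q.κ (b k)).le_opNorm _).trans ?_)
    rw [WithLp.norm_toLp_fst]
    simpa using hL
  have hres : ‖residual D Q.κ (b k) (d k)‖ ≤
      Q.rHat * (1 + (1 + Q.r * Q.epsHat) * L) * x ^ (1 + Q.τ) := by
    calc ‖residual D Q.κ (b k) (d k)‖
        ≤ Q.eta D (b k) * ‖D.E Q.κ (b k) + (d k).eps • partialEps D Q.κ (b k)‖ :=
          h.residual_le_eta k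
      _ ≤ (Q.rHat * x ^ Q.τ) * (x + (1 + Q.r * Q.epsHat) * x * L) := by
        refine mul_le_mul (min_le_right _ _) ((norm_add_le _ _).trans (add_le_add hE ?_))
          (norm_nonneg _) (by positivity)
        rw [norm_smul, Real.norm_eq_abs]
        exact mul_le_mul hde hpart (norm_nonneg _) (by positivity)
      _ = _ := by rw [hpow]; ring
  have hsum : ‖D.Ehat Q.κ (b k) + D.newtonDeriv Q.κ (b k) (d k)‖ ≤
      Q.zeta D (b k) * Q.epsHat + ‖residual D Q.κ (b k) (d k)‖ := by
    refine le_of_sq_le_sq ?_ (by positivity)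
    rw [h.norm_Ehat_add_sq k]
    nlinarith [mul_nonneg hζ0.le (norm_nonneg (residual D Q.κ (b k) (d k)))]
  linarith

end IsRun

open State

/-! ### Convergence -/

namespace IsRun

variable {T m₁ m₂ n : ℕ} {D : CVData T m₁ m₂ n} {Q : Params} {b d : ℕ → State T n} {ℓ : ℕ → ℕ}
  {x₀ : State T n}

theorem eps_nonneg_of_mapClusterPt (h : IsRun D Q b d ℓ) (hacc : MapClusterPt x₀ atTop b) :
    0 ≤ x₀.eps := by
  by_contra hneg
  have hev := (epsL T n).continuous.continuousAt.eventually (gt_mem_nhds (not_le.1 hneg))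
  obtain ⟨k, hk⟩ := (hacc.frequently hev).exists
  exact absurd (h.eps_pos k) (not_lt.2 (le_of_lt hk))

/-- If `𝓔̂ ≠ 0` at a cluster point, then the decreasing sequence `‖𝓔̂(bᵏ)‖` stays away from zero, and
with it `ζ_k`; as `εᵏ⁺¹` is a convex combination of `εᵏ` and `ζ_k ε̂`, so does `εᵏ`. -/
theorem eps_pos_of_mapClusterPt (h : IsRun D Q b d ℓ) (hacc : MapClusterPt x₀ atTop b)
    (hx₀ : D.Ehat Q.κ x₀ ≠ 0) : 0 < x₀.eps := by
  refine (h.eps_nonneg_of_mapClusterPt hacc).lt_of_ne' fun he => ?_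
  obtain ⟨K, hK, hexp⟩ := exists_norm_sub_huberDeriv_le (D.contDiff_smoothPart Q.κ)
    D.contDiff_huberArg (D.Ehat_eq Q.κ) (x₀ := x₀) he
  obtain ⟨L, hL, hbdd⟩ := exists_norm_huberDeriv_le (π := epsL T n) (e := unitC T n)
    (D.contDiff_smoothPart Q.κ) D.contDiff_huberArg x₀
  set m := ‖D.Ehat Q.κ x₀‖ / 2 with hm
  have hm0 : 0 < m := half_pos (norm_pos_iff.2 hx₀)
  have hsmall : ∀ᶠ x in 𝓝 x₀, L * ‖x - x₀‖ + K * ‖x - x₀‖ ^ 2 < m := by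
    have hc : ContinuousAt (fun x => L * ‖x - x₀‖ + K * ‖x - x₀‖ ^ 2) x₀ := by fun_prop
    exact hc.eventually (gt_mem_nhds (by simpa using hm0))
  have hlow : ∀ᶠ x in 𝓝 x₀, 0 < x.eps → m ≤ ‖D.Ehat Q.κ x‖ := by
    filter_upwards [eventually_nhdsWithin_iff.1 hexp, hbdd, hsmall] with x h1 h2 h3 hx
    have h1 := h1 hx
    have h2 := (ContinuousLinearMap.le_opNorm _ (x - x₀)).trans
      (mul_le_mul_of_nonneg_right (h2 _ (huberSlope_mem (epsL T n x) (D.huberArg x)))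
        (norm_nonneg (x - x₀)))
    have h4 := norm_sub_norm_le (D.Ehat Q.κ x₀) (D.Ehat Q.κ x)
    have h5 := norm_le_norm_add_norm_sub' (D.Ehat Q.κ x - D.Ehat Q.κ x₀)
      (huberDeriv (D.smoothPart Q.κ) D.huberArg (epsL T n) (unitC T n) x
        (huberSlope (epsL T n x) (D.huberArg x)) (x - x₀))
    rw [norm_sub_rev (D.Ehat Q.κ x)] at h5
    linarith
  have hfreq := (hacc.frequently hlow).mono fun k hk => hk (h.eps_pos k)
  have hall : ∀ k, m ≤ ‖D.Ehat Q.κ (b k)‖ := fun k => by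
    obtain ⟨j, hj, hkj⟩ := (hfreq.and_eventually (eventually_ge_atTop k)).exists
    exact hj.trans (h.antitone_norm hkj)
  set z := Q.r * min 1 (m ^ (1 + Q.τ)) * Q.epsHat with hz
  have hz0 : 0 < z := mul_pos (mul_pos Q.r_mem.1 (lt_min one_pos (Real.rpow_pos_of_pos hm0 _)))
    Q.epsHat_pos
  have hζ : ∀ k, z ≤ Q.zeta D (b k) * Q.epsHat := fun k => by
    refine mul_le_mul_of_nonneg_right (mul_le_mul_of_nonneg_left (min_le_min le_rfl ?_)
      Q.r_mem.1.le) Q.epsHat_pos.le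
    exact Real.rpow_le_rpow hm0.le (hall k) (by linarith [Q.τ_mem.1])
  have hmin : 0 < min (b 0).eps z := lt_min h.eps_zero_pos hz0
  have hev : ∀ᶠ x in 𝓝 x₀, epsL T n x < min (b 0).eps z := by
    refine (epsL T n).continuous.continuousAt.eventually (gt_mem_nhds ?_)
    rw [show epsL T n x₀ = 0 from he]
    exact hmin
  obtain ⟨k, hk⟩ := (hacc.frequently hev).exists
  exact absurd (h.min_le_eps hζ k) (not_le.2 hk)

/-- If `z > 0` at a cluster point, then the derivatives of `𝓔̂` are uniformly invertible near it,
with one bound for all slopes of the Huber function. -/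
theorem exists_norm_le_newtonDeriv (h : IsRun D Q b d ℓ) (hacc : MapClusterPt x₀ atTop b)
    (hz : 0 < D.z x₀.mu x₀.C x₀.w) :
    ∃ M : ℝ, 0 < M ∧ ∀ᶠ x in 𝓝 x₀, ∀ y, ‖y‖ ≤ M * ‖D.newtonDeriv Q.κ x y‖ := by
  obtain ⟨M, hM, hinv⟩ := exists_norm_le_of_injective
    (J := huberDeriv (D.smoothPart Q.κ) D.huberArg (epsL T n) (unitC T n))
    (continuous_huberDeriv (D.contDiff_smoothPart Q.κ) D.contDiff_huberArg) isCompact_Icc x₀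
    (fun s hs y hy => D.eq_zero_of_huberDeriv_eq_zero Q.κ_pos
      (h.eps_nonneg_of_mapClusterPt hacc) hz hs hy)
  exact ⟨M, hM, hinv.mono fun x hx => hx _ (huberSlope_mem _ _)⟩

theorem Ehat_eq_zero (h : IsRun D Q b d ℓ) (hacc : MapClusterPt x₀ atTop b)
    (hz : 0 < D.z x₀.mu x₀.C x₀.w) : D.Ehat Q.κ x₀ = 0 := by
  by_contra hne
  obtain ⟨M, hM, hinv⟩ := h.exists_norm_le_newtonDeriv hacc hz
  have hpos : 0 < epsL T n x₀ := h.eps_pos_of_mapClusterPt hacc hne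
  have hF := D.contDiff_smoothPart (N := 2) Q.κ
  have hθ := D.contDiff_huberArg (N := 2)
  have hstrict : HasStrictFDerivAt (D.Ehat Q.κ) (D.newtonDeriv Q.κ x₀) x₀ :=
    hasStrictFDerivAt_of_eq_sub_huber hF hθ (D.Ehat_eq Q.κ) hpos
  have hcont : ContinuousAt (D.newtonDeriv Q.κ) x₀ := continuousAt_huberDeriv hF hθ hpos
  refine hne (eq_zero_of_mapClusterPt hstrict hcont hM hinv Q.delta_nonneg Q.delta_lt_one
    Q.σ_mem.1 Q.σ_mem.2 Q.ρ_mem.1 Q.ρ_mem.2 (.of_forall ?_) h.line_search h.update hacc)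
  rintro _ k rfl
  exact h.norm_Ehat_add_le k

/-- Close to the cluster point the unit step is accepted, and contracts with order `1 + τ`. -/
theorem exists_local_step (h : IsRun D Q b d ℓ) (hacc : MapClusterPt x₀ atTop b)
    (hz : 0 < D.z x₀.mu x₀.C x₀.w) :
    ∃ A : ℝ, ∀ᶠ x in 𝓝[{x | 0 < epsL T n x}] x₀, ∀ k, b k = x →
      (ℓ k = 0 ∧ b (k + 1) = b k + d k) ∧
      ‖b (k + 1) - x₀‖ ≤ A * ‖b k - x₀‖ ^ (1 + Q.τ) ∧
      ‖b (k + 1) - x₀‖ ≤ 1 / 2 * ‖b k - x₀‖ := by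
  have hzero := h.Ehat_eq_zero hacc hz
  obtain ⟨M, hM, hinv⟩ := h.exists_norm_le_newtonDeriv hacc hz
  have hF := D.contDiff_smoothPart (N := 2) Q.κ
  have hθ := D.contDiff_huberArg (N := 2)
  have heps0 : epsL T n x₀ = 0 := congrArg (epsL T n) hzero
  obtain ⟨K, hK, hexp⟩ := exists_norm_sub_huberDeriv_le hF hθ (D.Ehat_eq Q.κ) heps0
  obtain ⟨L, hL, hbdd⟩ := exists_norm_huberDeriv_le (π := epsL T n) (e := unitC T n) hF hθ x₀
  have hbdd' : ∀ᶠ x in 𝓝 x₀, ‖D.newtonDeriv Q.κ x‖ ≤ L :=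
    hbdd.mono fun x hx => hx _ (huberSlope_mem _ _)
  have hγ : 0 < 1 - 2 * Q.σ * (1 - Q.delta) := by
    nlinarith [Q.σ_mem.1, Q.σ_mem.2, Q.delta_nonneg]
  have hc : 0 ≤ Q.r * Q.epsHat + Q.rHat * (1 + (1 + Q.r * Q.epsHat) * L) := by
    have h1 := Q.r_mem.1
    have h2 := Q.epsHat_pos
    have h3 := Q.rHat_pos
    positivity
  obtain ⟨A, hA⟩ := exists_forall_newton_step (DH := D.newtonDeriv Q.κ) hzero hM hL hK hc Q.τ_mem.1
    Q.τ_mem.2 hγ (eventually_nhdsWithin_of_eventually_nhds hinv)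
    (eventually_nhdsWithin_of_eventually_nhds hbdd') hexp
  refine ⟨A, ?_⟩
  filter_upwards [hA, eventually_nhdsWithin_of_eventually_nhds hbdd'] with x hx hxL
  rintro k rfl
  have hS : 0 < epsL T n (b k + d k) := by
    have h1 : epsL T n (b k + d k) = (b k).eps + (d k).eps := rfl
    rw [h1, h.eps_step k, add_neg_cancel_left]
    exact mul_pos (Q.zeta_pos D (h.not_solved k)) Q.epsHat_pos
  obtain ⟨h1, h2, h3⟩ := hx (d k) hS (h.norm_Ehat_add_le_rpow k hxL)
  have hℓ : ℓ k = 0 := by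
    refine Nat.le_zero.1 ((h.line_search k).2 ?_)
    rw [Set.mem_ofPred_eq, pow_zero, one_smul, mul_one]
    exact h3
  have hb : b (k + 1) = b k + d k := by rw [h.update k, hℓ, pow_zero, one_smul]
  rw [hb]
  exact ⟨⟨hℓ, rfl⟩, h1, h2⟩

end IsRun

end SquaredSmoothingNewton

end

theorem mainTheorem1 {T m₁ m₂ n : ℕ} (hT : 0 < T) (hm₁ : 0 < m₁)
    (D : SquaredSmoothingNewton.CVData T m₁ m₂ n) (Q : SquaredSmoothingNewton.Params)
    (b d : ℕ → SquaredSmoothingNewton.State T n) (ℓ : ℕ → ℕ)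
    (hrun : SquaredSmoothingNewton.IsRun D Q b d ℓ)
    (bstar : SquaredSmoothingNewton.State T n)
    (hacc : MapClusterPt bstar atTop b)
    (hz : 0 < D.z bstar.mu bstar.C bstar.w) :
    D.Ehat Q.κ bstar = 0 ∧
    Tendsto b atTop (𝓝 bstar) ∧
    (fun k => b (k + 1) - bstar) =O[atTop] (fun k => ‖b k - bstar‖ ^ (1 + Q.τ)) ∧
    (fun k => b (k + 1) - bstar) =o[atTop] (fun k => b k - bstar) ∧
    (∀ᶠ k in atTop, ℓ k = 0 ∧ b (k + 1) = b k + d k) := by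
  have hτ := Q.τ_mem.1
  obtain ⟨A, hA⟩ := hrun.exists_local_step hacc hz
  obtain ⟨hlim, hO, hunit⟩ :=
    SquaredSmoothingNewton.tendsto_and_isBigO_of_local_contraction (b := b)
      (S := {x | 0 < SquaredSmoothingNewton.State.epsL T n x}) hrun.eps_pos hacc hA
  refine ⟨hrun.Ehat_eq_zero hacc hz, hlim, hO, hO.trans_isLittleO ?_, hunit⟩
  have hτlim : Tendsto (fun k => ‖b k - bstar‖ ^ Q.τ) atTop (𝓝 0) := by
    have h := (tendsto_iff_norm_sub_tendsto_zero.1 hlim).rpow_const (p := Q.τ) (Or.inr hτ.le)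
    rwa [Real.zero_rpow hτ.ne'] at h
  refine isLittleO_iff.2 fun c hc => ?_
  filter_upwards [hτlim.eventually (gt_mem_nhds hc)] with k hk
  rw [Real.norm_of_nonneg (Real.rpow_nonneg (norm_nonneg _) _), add_comm,
    Real.rpow_add_of_nonneg (norm_nonneg _) hτ.le zero_le_one, Real.rpow_one]
  exact mul_le_mul_of_nonneg_right hk.le (norm_nonneg _)
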